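/- **Conventions.** 2-categories are strict. For 2-categories $\mathcal X,\mathcal Y$, $\mathrm{Lax}_{\mathrm{op}}(\mathcal X,\mathcal Y)$ is the 2-category of lax functors $F\colon\mathcal X\to\mathcal Y$ (with unitors $\iota_X\colon \mathrm{id}_{FX}\to F(\mathrm{id}_X)$ and compositors $\gamma_{f',f}\colon F(f')F(f)\to F(f'f)$), oplax transformations $\theta\colon F\to G$ (with 2-morphisms $\theta_f\colon \theta_{X_2}F(f)\to G(f)\theta_{X_1}$ for $f\colon X_1\to X_2$) and modifications. Let $\mathcal B,\mathcal C,\mathcal D$ be 2-categories. Below $f\colon B_1\to B_2$, $f'\colon B_2\to B_3$ are 1-morphisms of $\mathcal B$, and $g\colon C_1\to C_2$, $g'\colon C_2\to C_3$ are 1-morphisms of $\mathcal C$; $\alpha$ and $\beta$ are 2-morphisms of $\mathcal B$ and $\mathcal C$; $\circ$ is vertical and $\ast$ horizontal composition, and juxtaposition with a 1-morphism is whiskering. **Distributive laws.** A *distributive law* consists of lax functors $(L_C,\gamma^C,\iota^C)\colon\mathcal B\to\mathcal D$ for $C\in\mathcal C$ and $(M_B,\gamma^B,\iota^B)\colon\mathcal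 C\to\mathcal D$ for $B\in\mathcal B$ with $L_C(B)=M_B(C)$, and of 2-morphisms $\sigma_{f,g}\colon L_{C_2}(f)M_{B_1}(g)\to M_{B_2}(g)L_{C_1}(f)$ such that 1. $\sigma_{f,g'g}\circ L_{C_3}(f)\gamma^{B_1}_{g',g}=\gamma^{B_2}_{g',g}L_{C_1}(f)\circ M_{B_2}(g')\sigma_{f,g}\circ\sigma_{f,g'}M_{B_1}(g)$, 2. $\sigma_{f'f,g}\circ\gamma^{C_2}_{f',f}M_{B_1}(g)=M_{B_3}(g)\gamma^{C_1}_{f',f}\circ\sigma_{f',g}L_{C_1}(f)\circ L_{C_2}(f')\sigma_{f,g}$, 3. $\sigma_{f,\mathrm{id}_C}\circ L_C(f)\iota^{B_1}_C=\iota^{B_2}_CL_C(f)$, 4. $\sigma_{\mathrm{id}_B,g}\circ\iota^{C_2}_BM_B(g)=M_B(g)\iota^{C_1}_B$, 5. $\sigma_{f,\bar g}\circ L_{C_2}(f)M_{B_1}(\beta)=M_{B_2}(\beta)L_{C_1}(f)\circ\sigma_{f,g}$ for $\beta\colon g\to \bar g$, 6. $\sigma_{\bar f,g}\circ L_{C_2}(\alpha)M_{B_1}(g)=M_{B_2}(g)L_{C_1}(\alpha)\circ\sigma_{f,g}$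 for $\alpha\colon f\to \bar f$. A *morphism* $\overline\theta\colon\sigma^1\to\sigma^2$ consists of families of oplax transformations $\theta^C\colon L^1_C\to L^2_C$ and $\theta^B\colon M^1_B\to M^2_B$ with $\theta^C_B=\theta^B_C$ satisfying the Yang–Baxter equation $$M^2_{B_2}(g)\theta^{C_1}_f\circ\theta^{B_2}_gL^1_{C_1}(f)\circ\theta^{B_2}_{C_2}\sigma^1_{f,g}=\sigma^2_{f,g}\theta^{B_1}_{C_1}\circ L^2_{C_2}(f)\theta^{B_1}_g\circ\theta^{C_2}_fM^1_{B_1}(g).$$ A *2-morphism* $\overline\beth\colon\overline\theta\to\overline\zeta$ consists of families of modifications $\beth^B\colon\theta^B\to\zeta^B$ and $\beth^C\colon\theta^C\to\zeta^C$ with $\beth^B_C=\beth^C_B$. With componentwise composition these form a 2-category $\mathrm{Dist}(\mathcal B,\mathcal C,\mathcal D)$. **Collation.** $K$ assigns to a distributive law $\sigma$ the lax functor $P\colon\mathcal B\times\mathcal C\to\mathcal D$ with $P(B,C)=L_C(B)=M_B(C)$, $P(f,g)=M_{B_2}(g)L_{C_1}(f)$, $P(\alpha,\beta)=M_{B_2}(\beta)\ast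 L_{C_1}(\alpha)$, unitor $\iota^B_C\ast\iota^C_B$ and compositor $$P(f',g')P(f,g)\to P(f'f,g'g),\qquad (\gamma^{B_3}_{g',g}\ast\gamma^{C_1}_{f',f})\circ M_{B_3}(g')\sigma_{f',g}L_{C_1}(f);$$ to a morphism $\overline\theta$ the oplax transformation $\theta\colon P^1\to P^2$ with $\theta_{B,C}=\theta^B_C$ and $\theta_{f,g}=M^2_{B_2}(g)\theta^{C_1}_f\circ\theta^{B_2}_gL^1_{C_1}(f)$; and to a 2-morphism $\overline\beth$ the modification with components $\beth_{B,C}=\beth^B_C$. **Iteration.** $\Phi$ assigns to $\sigma$ the lax functor $Q\colon\mathcal B\to\mathrm{Lax}_{\mathrm{op}}(\mathcal C,\mathcal D)$ with $Q(B)=M_B$, $Q(f)_C=L_C(f)$, $Q(f)_g=\sigma_{f,g}$, $Q(\alpha)_C=L_C(\alpha)$, $(\iota_B)_C=\iota^C_B$, $(\gamma_{f',f})_C=\gamma^C_{f',f}$; to $\overline\theta$ the oplax transformation $\widehat\theta$ with $\widehat\theta_B=\theta^B$ and $(\widehat\theta_f)_C=\theta^C_f$; and to $\overline\beth$ the modification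 $\widehat\beth$ with $\widehat\beth_B=\beth^B$. In the other direction, $\Psi$ assigns to $Q$ the distributive law with $M_B=Q(B)$, $L_C=Q(-)_C$ (with structure 2-morphisms the $C$-components of those of $Q$) and $\sigma_{f,g}=Q(f)_g$; to $\widehat\theta$ the families $\theta^B=\widehat\theta_B$ and $\theta^C$, where $\theta^C_B=(\widehat\theta_B)_C$ and $\theta^C_f=(\widehat\theta_f)_C$; and to $\widehat\beth$ the families $\beth^B=\widehat\beth_B$ and $\beth^C_B=(\widehat\beth_B)_C$. **Uncurrying.** $J$ assigns to a lax functor $Q\colon\mathcal B\to\mathrm{Lax}_{\mathrm{op}}(\mathcal C,\mathcal D)$ the lax functor $\mathcal B\times\mathcal C\to\mathcal D$ with $(B,C)\mapsto Q(B)(C)$, $(f,g)\mapsto Q(B_2)(g)\,Q(f)_{C_1}$, $(\alpha,\beta)\mapsto Q(B_2)(\beta)\ast Q(\alpha)_{C_1}$, unitor $\iota^{Q(B)}_C\ast(\iota^Q_B)_C$ and compositor $\bigl(\gamma^{Q(B_3)}_{g',g}\ast(\gamma^Q_{f',f})_{C_1}\bigr)\circ Q(B_3)(g')\,Q(f')_g\,Q(f)_{C_1}$;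 to an oplax transformation $\theta\colon Q^1\to Q^2$ the one with components $(\theta_B)_C$ and 2-morphisms $Q^2(B_2)(g)(\theta_f)_{C_1}\circ(\theta_{B_2})_g\,Q^1(f)_{C_1}$; and to a modification $\beth$ the one with components $(\beth_B)_C$. **Theorem.** Collation defines a strict 2-functor $K\colon\mathrm{Dist}(\mathcal B,\mathcal C,\mathcal D)\to\mathrm{Lax}_{\mathrm{op}}(\mathcal B\times\mathcal C,\mathcal D)$. Moreover $\Phi\colon\mathrm{Dist}(\mathcal B,\mathcal C,\mathcal D)\to\mathrm{Lax}_{\mathrm{op}}(\mathcal B,\mathrm{Lax}_{\mathrm{op}}(\mathcal C,\mathcal D))$ and $\Psi$ are strict 2-functors inverse to each other, uncurrying defines a strict 2-functor $J\colon\mathrm{Lax}_{\mathrm{op}}(\mathcal B,\mathrm{Lax}_{\mathrm{op}}(\mathcal C,\mathcal D))\to\mathrm{Lax}_{\mathrm{op}}(\mathcal B\times\mathcal C,\mathcal D)$, and $J\circ\Phi=K$. -/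

import Mathlib

open CategoryTheory Bicategory
open scoped CategoryTheory.Lax.OplaxTrans CategoryTheory.Lax.OplaxTrans.LaxFunctor

universe w₁ w₂ w₃ v₁ v₂ v₃ u₁ u₂ u₃

/-- A lax functor from `B` to `D` whose action on objects is the given function `obj`. The fields
are those of Mathlib's `LaxFunctor`; prescribing `obj` allows two families of lax functors to share
their values on objects. -/
structure LaxFunctorOn (B : Type u₁) [Bicategory.{w₁, v₁} B] (D : Type u₂) [Bicategory.{w₂, v₂} D]
    (obj : B → D) where
  map {a b : B} (f : a ⟶ b) : obj a ⟶ obj b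
  map₂ {a b : B} {f g : a ⟶ b} (η : f ⟶ g) : map f ⟶ map g
  map₂_id {a b : B} (f : a ⟶ b) : map₂ (𝟙 f) = 𝟙 (map f)
  map₂_comp {a b : B} {f g h : a ⟶ b} (η : f ⟶ g) (θ : g ⟶ h) :
    map₂ (η ≫ θ) = map₂ η ≫ map₂ θ
  mapId (a : B) : 𝟙 (obj a) ⟶ map (𝟙 a)
  mapComp {a b c : B} (f : a ⟶ b) (g : b ⟶ c) : map f ≫ map g ⟶ map (f ≫ g)
  mapComp_naturality_left {a b c : B} {f f' : a ⟶ b} (η : f ⟶ f') (g : b ⟶ c) :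
    mapComp f g ≫ map₂ (η ▷ g) = map₂ η ▷ map g ≫ mapComp f' g
  mapComp_naturality_right {a b c : B} (f : a ⟶ b) {g g' : b ⟶ c} (η : g ⟶ g') :
    mapComp f g ≫ map₂ (f ◁ η) = map f ◁ map₂ η ≫ mapComp f g'
  map₂_associator {a b c d : B} (f : a ⟶ b) (g : b ⟶ c) (h : c ⟶ d) :
    mapComp f g ▷ map h ≫ mapComp (f ≫ g) h ≫ map₂ (α_ f g h).hom =
      (α_ (map f) (map g) (map h)).hom ≫ map f ◁ mapComp g h ≫ mapComp f (g ≫ h)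
  map₂_leftUnitor {a b : B} (f : a ⟶ b) :
    map₂ (λ_ f).inv = (λ_ (map f)).inv ≫ mapId a ▷ map f ≫ mapComp (𝟙 a) f
  map₂_rightUnitor {a b : B} (f : a ⟶ b) :
    map₂ (ρ_ f).inv = (ρ_ (map f)).inv ≫ map f ◁ mapId b ≫ mapComp f (𝟙 b)

namespace LaxFunctorOn

variable {B : Type u₁} [Bicategory.{w₁, v₁} B] {D : Type u₂} [Bicategory.{w₂, v₂} D]

/-- The underlying lax functor. -/
@[simps]
def toLaxFunctor {obj : B → D} (F : LaxFunctorOn B D obj) : B ⥤ᴸ D where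
  obj := obj
  map := F.map
  map₂ := F.map₂
  map₂_id := F.map₂_id
  map₂_comp := F.map₂_comp
  mapId := F.mapId
  mapComp := F.mapComp
  mapComp_naturality_left := F.mapComp_naturality_left
  mapComp_naturality_right := F.mapComp_naturality_right
  map₂_associator := F.map₂_associator
  map₂_leftUnitor := F.map₂_leftUnitor
  map₂_rightUnitor := F.map₂_rightUnitor

end LaxFunctorOn

/-- An oplax transformation between the lax functors `F` and `G` whose component 1-morphisms are
the given family `app`. The fields are those of Mathlib's `Lax.OplaxTrans`. -/
structure OplaxTransOn {B : Type u₁} [Bicategory.{w₁, v₁} B] {D : Type u₂} [Bicategory.{w₂, v₂} D]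
    {obj obj' : B → D} (F : LaxFunctorOn B D obj) (G : LaxFunctorOn B D obj')
    (app : ∀ a, obj a ⟶ obj' a) where
  naturality {a b : B} (f : a ⟶ b) : F.map f ≫ app b ⟶ app a ≫ G.map f
  naturality_naturality {a b : B} {f g : a ⟶ b} (η : f ⟶ g) :
    F.map₂ η ▷ app b ≫ naturality g = naturality f ≫ app a ◁ G.map₂ η
  naturality_id (a : B) :
    F.mapId a ▷ app a ≫ naturality (𝟙 a) =
      (λ_ (app a)).hom ≫ (ρ_ (app a)).inv ≫ app a ◁ G.mapId a
  naturality_comp {a b c : B} (f : a ⟶ b) (g : b ⟶ c) :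
    F.mapComp f g ▷ app c ≫ naturality (f ≫ g) =
      (α_ _ _ _).hom ≫ F.map f ◁ naturality g ≫
        (α_ _ _ _).inv ≫ naturality f ▷ G.map g ≫ (α_ _ _ _).hom ≫
          app a ◁ G.mapComp f g

namespace OplaxTransOn

variable {B : Type u₁} [Bicategory.{w₁, v₁} B] {D : Type u₂} [Bicategory.{w₂, v₂} D]
    {obj obj' obj'' : B → D} {F : LaxFunctorOn B D obj} {G : LaxFunctorOn B D obj'}
    {H : LaxFunctorOn B D obj''} {app : ∀ a, obj a ⟶ obj' a} {app' : ∀ a, obj' a ⟶ obj'' a}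

/-- The underlying oplax transformation. -/
@[simps]
def toOplaxTrans (θ : OplaxTransOn F G app) : F.toLaxFunctor ⟶ G.toLaxFunctor :=
  Lax.OplaxTrans.mk (F := F.toLaxFunctor) (G := G.toLaxFunctor) app θ.naturality
    θ.naturality_naturality θ.naturality_id θ.naturality_comp

variable (F) in
/-- The identity oplax transformation. -/
@[simps]
def id : OplaxTransOn F F (fun a => 𝟙 (obj a)) where
  naturality f := (ρ_ (F.map f)).hom ≫ (λ_ (F.map f)).inv
  naturality_naturality := (Lax.OplaxTrans.id F.toLaxFunctor).naturality_naturality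
  naturality_id := (Lax.OplaxTrans.id F.toLaxFunctor).naturality_id
  naturality_comp := (Lax.OplaxTrans.id F.toLaxFunctor).naturality_comp

/-- The composite of two oplax transformations. -/
@[simps]
def comp (θ : OplaxTransOn F G app) (ζ : OplaxTransOn G H app') :
    OplaxTransOn F H (fun a => app a ≫ app' a) where
  naturality {a b} f := (α_ _ _ _).inv ≫ θ.naturality f ▷ app' b ≫ (α_ _ _ _).hom ≫
    app a ◁ ζ.naturality f ≫ (α_ _ _ _).inv
  naturality_naturality := (Lax.OplaxTrans.vComp θ.toOplaxTrans ζ.toOplaxTrans).naturality_naturality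
  naturality_id := (Lax.OplaxTrans.vComp θ.toOplaxTrans ζ.toOplaxTrans).naturality_id
  naturality_comp := (Lax.OplaxTrans.vComp θ.toOplaxTrans ζ.toOplaxTrans).naturality_comp

end OplaxTransOn

/-- A distributive law between a family of lax functors `L c : B → D` and a family of lax functors
`M b : C → D`, which agree on objects: `(L c) b = (M b) c = obj b c`. Composition is written in
diagrammatic order, so `dist f g` is a 2-morphism from `L c' f ∘ M b g` to `M b' g ∘ L c f`. -/
structure DistLaw (B : Type u₁) [Bicategory.{w₁, v₁} B] (C : Type u₂) [Bicategory.{w₂, v₂} C]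
    (D : Type u₃) [Bicategory.{w₃, v₃} D] where
  obj : B → C → D
  L (c : C) : LaxFunctorOn B D (fun b => obj b c)
  M (b : B) : LaxFunctorOn C D (fun c => obj b c)
  dist {b b' : B} {c c' : C} (f : b ⟶ b') (g : c ⟶ c') :
    (M b).map g ≫ (L c').map f ⟶ (L c).map f ≫ (M b').map g
  /-- `dist` is compatible with the compositors of the `M` family. -/
  dist_M_comp {b b' : B} {c c' c'' : C} (f : b ⟶ b') (g : c ⟶ c') (g' : c' ⟶ c'') :
    (M b).mapComp g g' ▷ (L c'').map f ≫ dist f (g ≫ g') =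
      (α_ _ _ _).hom ≫ (M b).map g ◁ dist f g' ≫ (α_ _ _ _).inv ≫
        dist f g ▷ (M b').map g' ≫ (α_ _ _ _).hom ≫ (L c).map f ◁ (M b').mapComp g g'
  /-- `dist` is compatible with the compositors of the `L` family. -/
  dist_L_comp {b b' b'' : B} {c c' : C} (f : b ⟶ b') (f' : b' ⟶ b'') (g : c ⟶ c') :
    (M b).map g ◁ (L c').mapComp f f' ≫ dist (f ≫ f') g =
      (α_ _ _ _).inv ≫ dist f g ▷ (L c').map f' ≫ (α_ _ _ _).hom ≫
        (L c).map f ◁ dist f' g ≫ (α_ _ _ _).inv ≫ (L c).mapComp f f' ▷ (M b'').map g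
  /-- `dist` is compatible with the unitors of the `M` family. -/
  dist_M_id {b b' : B} (c : C) (f : b ⟶ b') :
    (M b).mapId c ▷ (L c).map f ≫ dist f (𝟙 c) =
      (λ_ _).hom ≫ (ρ_ _).inv ≫ (L c).map f ◁ (M b').mapId c
  /-- `dist` is compatible with the unitors of the `L` family. -/
  dist_L_id {c c' : C} (b : B) (g : c ⟶ c') :
    (M b).map g ◁ (L c').mapId b ≫ dist (𝟙 b) g =
      (ρ_ _).hom ≫ (λ_ _).inv ≫ (L c).mapId b ▷ (M b).map g
  /-- `dist` is natural with respect to the 2-morphisms of `C`. -/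
  dist_M_map₂ {b b' : B} {c c' : C} (f : b ⟶ b') {g g' : c ⟶ c'} (β : g ⟶ g') :
    (M b).map₂ β ▷ (L c').map f ≫ dist f g' = dist f g ≫ (L c).map f ◁ (M b').map₂ β
  /-- `dist` is natural with respect to the 2-morphisms of `B`. -/
  dist_L_map₂ {b b' : B} {c c' : C} {f f' : b ⟶ b'} (α : f ⟶ f') (g : c ⟶ c') :
    (M b).map g ◁ (L c').map₂ α ≫ dist f' g = dist f g ≫ (L c).map₂ α ▷ (M b').map g

namespace DistLaw

variable {B : Type u₁} [Bicategory.{w₁, v₁} B] {C : Type u₂} [Bicategory.{w₂, v₂} C]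
    {D : Type u₃} [Bicategory.{w₃, v₃} D]

/-- A morphism of distributive laws: families of oplax transformations `σ.L c → τ.L c` and
`σ.M b → τ.M b` with common components `app b c`, satisfying the Yang–Baxter equation. -/
structure Hom (σ τ : DistLaw B C D) where
  app (b : B) (c : C) : σ.obj b c ⟶ τ.obj b c
  L (c : C) : OplaxTransOn (σ.L c) (τ.L c) (fun b => app b c)
  M (b : B) : OplaxTransOn (σ.M b) (τ.M b) (fun c => app b c)
  yang_baxter {b b' : B} {c c' : C} (f : b ⟶ b') (g : c ⟶ c') :
    σ.dist f g ▷ app b' c' ≫ (α_ _ _ _).hom ≫ (σ.L c).map f ◁ (M b').naturality g ≫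
        (α_ _ _ _).inv ≫ (L c).naturality f ▷ (τ.M b').map g ≫ (α_ _ _ _).hom =
      (α_ _ _ _).hom ≫ (σ.M b).map g ◁ (L c').naturality f ≫ (α_ _ _ _).inv ≫
        (M b).naturality g ▷ (τ.L c').map f ≫ (α_ _ _ _).hom ≫ app b c ◁ τ.dist f g

/-- A 2-morphism of distributive laws: families of modifications `θ.L c → ζ.L c` and
`θ.M b → ζ.M b` with common components `app b c`. -/
@[ext]
structure Hom₂ {σ τ : DistLaw B C D} (θ ζ : Hom σ τ) where
  app (b : B) (c : C) : θ.app b c ⟶ ζ.app b c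
  naturality_L {b b' : B} (c : C) (f : b ⟶ b') :
    (σ.L c).map f ◁ app b' c ≫ (ζ.L c).naturality f =
      (θ.L c).naturality f ≫ app b c ▷ (τ.L c).map f
  naturality_M {c c' : C} (b : B) (g : c ⟶ c') :
    (σ.M b).map g ◁ app b c' ≫ (ζ.M b).naturality g =
      (θ.M b).naturality g ≫ app b c ▷ (τ.M b).map g

theorem comp_assoc₆ {X : Type*} [Category* X] {a b c d e f g : X} (p : a ⟶ b) (q : b ⟶ c)
    (r : c ⟶ d) (s : d ⟶ e) (t : e ⟶ f) (u : f ⟶ g) :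
    p ≫ q ≫ r ≫ s ≫ t ≫ u = (p ≫ q ≫ r ≫ s ≫ t) ≫ u := by
  simp only [Category.assoc]

/-- The oplax transformation `M b → M b'` with components `L c f` and with 2-morphisms
`dist f g`. -/
def iterMap (σ : DistLaw B C D) {b b' : B} (f : b ⟶ b') :
    (σ.M b).toLaxFunctor ⟶ (σ.M b').toLaxFunctor :=
  Lax.OplaxTrans.mk (F := (σ.M b).toLaxFunctor) (G := (σ.M b').toLaxFunctor)
    (fun c => (σ.L c).map f) (fun g => σ.dist f g)
    (fun β => σ.dist_M_map₂ f β) (fun c => σ.dist_M_id c f) (fun g g' => σ.dist_M_comp f g g')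

/-- The lax functor from `B` to the 2-category of lax functors `C → D`, oplax transformations and
modifications that corresponds to a distributive law. -/
def toIterated (σ : DistLaw B C D) : B ⥤ᴸ (C ⥤ᴸ D) where
  obj b := (σ.M b).toLaxFunctor
  map f := σ.iterMap f
  map₂ α := ⟨⟨fun c => (σ.L c).map₂ α, fun g => σ.dist_L_map₂ α g⟩⟩
  map₂_id f := by ext c; exact (σ.L c).map₂_id f
  map₂_comp α β := by ext c; exact (σ.L c).map₂_comp α β
  mapId b := ⟨⟨fun c => (σ.L c).mapId b, fun g => (σ.dist_L_id b g).trans (Category.assoc _ _ _).symm⟩⟩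
  mapComp f f' := ⟨⟨fun c => (σ.L c).mapComp f f', fun g => (σ.dist_L_comp f f' g).trans
    (comp_assoc₆ _ _ _ _ _ _)⟩⟩
  mapComp_naturality_left α f := by ext c; exact (σ.L c).mapComp_naturality_left α f
  mapComp_naturality_right f _ _ α := by ext c; exact (σ.L c).mapComp_naturality_right f α
  map₂_associator f g h := by ext c; exact (σ.L c).map₂_associator f g h
  map₂_leftUnitor f := by ext c; exact (σ.L c).map₂_leftUnitor f
  map₂_rightUnitor f := by ext c; exact (σ.L c).map₂_rightUnitor f

theorem yang_baxter_iff {σ τ : DistLaw B C D} {app : ∀ (b : B) (c : C), σ.obj b c ⟶ τ.obj b c}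
    (L : ∀ c, OplaxTransOn (σ.L c) (τ.L c) (fun b => app b c))
    (M : ∀ b, OplaxTransOn (σ.M b) (τ.M b) (fun c => app b c))
    {b b' : B} (f : b ⟶ b') {c c' : C} (g : c ⟶ c') :
    (σ.dist f g ▷ app b' c' ≫ (α_ _ _ _).hom ≫ (σ.L c).map f ◁ (M b').naturality g ≫
        (α_ _ _ _).inv ≫ (L c).naturality f ▷ (τ.M b').map g ≫ (α_ _ _ _).hom =
      (α_ _ _ _).hom ≫ (σ.M b).map g ◁ (L c').naturality f ≫ (α_ _ _ _).inv ≫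
        (M b).naturality g ▷ (τ.L c').map f ≫ (α_ _ _ _).hom ≫ app b c ◁ τ.dist f g) ↔
    ((σ.M b).map g ◁ (L c').naturality f ≫ (α_ _ _ _).inv ≫
        (M b).naturality g ▷ (τ.L c').map f ≫ (α_ _ _ _).hom ≫ app b c ◁ τ.dist f g ≫
        (α_ _ _ _).inv =
      ((α_ _ _ _).inv ≫ σ.dist f g ▷ app b' c' ≫ (α_ _ _ _).hom ≫
        (σ.L c).map f ◁ (M b').naturality g ≫ (α_ _ _ _).inv) ≫
        (L c).naturality f ▷ (τ.M b').map g) := by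
  constructor
  · intro h
    have := (α_ _ _ _).inv ≫= h.symm =≫ (α_ _ _ _).inv
    simpa only [Category.assoc, Iso.hom_inv_id, Category.comp_id, Iso.inv_hom_id_assoc] using this
  · intro h
    have := (α_ _ _ _).hom ≫= h.symm =≫ (α_ _ _ _).hom
    simpa only [Category.assoc, Iso.inv_hom_id, Category.comp_id, Iso.hom_inv_id_assoc] using this

/-- The oplax transformation between iterated lax functors that corresponds to a morphism of
distributive laws. -/
def Hom.toIterated {σ τ : DistLaw B C D} (θ : Hom σ τ) : σ.toIterated ⟶ τ.toIterated :=
  Lax.OplaxTrans.mk (F := σ.toIterated) (G := τ.toIterated)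
    (fun b => (θ.M b).toOplaxTrans)
    (fun {b b'} f => ⟨⟨fun c => (θ.L c).naturality f, fun {c c'} g => by
        exact (yang_baxter_iff θ.L θ.M f g).1 (θ.yang_baxter f g)⟩⟩)
    (fun α => by ext c; exact (θ.L c).naturality_naturality α)
    (fun b => by ext c; exact (θ.L c).naturality_id b)
    (fun f g => by ext c; exact (θ.L c).naturality_comp f g)

/-- The identity morphism of a distributive law. -/
def Hom.id (σ : DistLaw B C D) : Hom σ σ where
  app b c := 𝟙 (σ.obj b c)
  L c := OplaxTransOn.id (σ.L c)
  M b := OplaxTransOn.id (σ.M b)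
  yang_baxter f g := by
    simp only [OplaxTransOn.id]
    bicategory

/-- Composition of morphisms of distributive laws: the two families are composed. -/
def Hom.comp {σ τ υ : DistLaw B C D} (θ : Hom σ τ) (ζ : Hom τ υ) : Hom σ υ where
  app b c := θ.app b c ≫ ζ.app b c
  L c := (θ.L c).comp (ζ.L c)
  M b := (θ.M b).comp (ζ.M b)
  yang_baxter f g := (yang_baxter_iff (fun c => (θ.L c).comp (ζ.L c))
    (fun b => (θ.M b).comp (ζ.M b)) f g).2 (((θ.toIterated ≫ ζ.toIterated).naturality f).as.naturality g)

/-- The 1-morphisms of the 2-category of distributive laws. -/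
instance categoryStruct : CategoryStruct (DistLaw B C D) where
  Hom := Hom
  id := Hom.id
  comp := Hom.comp

/-- The 2-morphisms of distributive laws compose componentwise. -/
instance homCategory (σ τ : DistLaw B C D) : Category (σ ⟶ τ) where
  Hom := Hom₂
  id θ :=
    { app := fun b c => 𝟙 (θ.app b c)
      naturality_L := fun c f => by simp
      naturality_M := fun c f => by simp }
  comp Γ Λ :=
    { app := fun b c => Γ.app b c ≫ Λ.app b c
      naturality_L := fun c f => by
        simp [Λ.naturality_L, reassoc_of% Γ.naturality_L]
      naturality_M := fun c f => by
        simp [Λ.naturality_M, reassoc_of% Γ.naturality_M] }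
  id_comp Γ := Hom₂.ext (by funext b c; exact Category.id_comp _)
  comp_id Γ := Hom₂.ext (by funext b c; exact Category.comp_id _)
  assoc Γ Λ Ξ := Hom₂.ext (by funext b c; exact Category.assoc _ _ _)

theorem hom₂_ext {σ τ : DistLaw B C D} {θ ζ : σ ⟶ τ} {Γ Λ : θ ⟶ ζ}
    (h : ∀ b c, Γ.app b c = Λ.app b c) : Γ = Λ :=
  Hom₂.ext (by funext b c; exact h b c)

/-- The modifications between the `L` parts. -/
def Hom₂.toL {σ τ : DistLaw B C D} {θ ζ : Hom σ τ} (Γ : Hom₂ θ ζ) (c : C) :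
    (θ.L c).toOplaxTrans ⟶ (ζ.L c).toOplaxTrans :=
  ⟨⟨fun b => Γ.app b c, fun f => Γ.naturality_L c f⟩⟩

/-- The modifications between the `M` parts. -/
def Hom₂.toM {σ τ : DistLaw B C D} {θ ζ : Hom σ τ} (Γ : Hom₂ θ ζ) (b : B) :
    (θ.M b).toOplaxTrans ⟶ (ζ.M b).toOplaxTrans :=
  ⟨⟨fun c => Γ.app b c, fun f => Γ.naturality_M b f⟩⟩

/-- An invertible 2-morphism of distributive laws from invertible components. -/
def Hom₂.isoMk {σ τ : DistLaw B C D} {θ ζ : σ ⟶ τ} (app : ∀ b c, θ.app b c ≅ ζ.app b c)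
    (hL : ∀ {b b' : B} (c : C) (f : b ⟶ b'),
    (σ.L c).map f ◁ (app b' c).hom ≫ (ζ.L c).naturality f =
      (θ.L c).naturality f ≫ (app b c).hom ▷ (τ.L c).map f)
  (hM : ∀ {c c' : C} (b : B) (g : c ⟶ c'),
    (σ.M b).map g ◁ (app b c').hom ≫ (ζ.M b).naturality g =
      (θ.M b).naturality g ≫ (app b c).hom ▷ (τ.M b).map g) : θ ≅ ζ where
  hom := { app b c := (app b c).hom, naturality_L := hL, naturality_M := hM }
  inv :=
    { app b c := (app b c).inv
      naturality_L {b b'} c f := by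
        simpa using (σ.L c).map f ◁ (app b' c).inv ≫= (hL c f).symm =≫ (app b c).inv ▷ (τ.L c).map f
      naturality_M {c c'} b g := by
        simpa using (σ.M b).map g ◁ (app b c').inv ≫= (hM b g).symm =≫ (app b c).inv ▷ (τ.M b).map g }
  hom_inv_id := hom₂_ext fun b c => (app b c).hom_inv_id
  inv_hom_id := hom₂_ext fun b c => (app b c).inv_hom_id

/-- The bicategory of distributive laws; the operations are computed componentwise, and it is a
strict 2-category as soon as `D` is one. -/
instance bicategory : Bicategory (DistLaw B C D) where
  homCategory σ τ := homCategory σ τ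
  whiskerLeft {_ _ _} θ _ _ Γ :=
    { app := fun b c => θ.app b c ◁ Γ.app b c
      naturality_L := fun c f => ((θ.L c).toOplaxTrans ◁ Γ.toL c).as.naturality f
      naturality_M := fun b g => ((θ.M b).toOplaxTrans ◁ Γ.toM b).as.naturality g }
  whiskerRight Γ ζ :=
    { app := fun b c => Γ.app b c ▷ ζ.app b c
      naturality_L := fun c f => (Γ.toL c ▷ (Hom.L ζ c).toOplaxTrans).as.naturality f
      naturality_M := fun b g => (Γ.toM b ▷ (Hom.M ζ b).toOplaxTrans).as.naturality g }
  associator θ ζ ξ := Hom₂.isoMk (fun b c => α_ (θ.app b c) (ζ.app b c) (ξ.app b c))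
    (fun c f => (α_ (θ.L c).toOplaxTrans (Hom.L ζ c).toOplaxTrans (ξ.L c).toOplaxTrans).hom.as.naturality f)
    (fun b g => (α_ (θ.M b).toOplaxTrans (Hom.M ζ b).toOplaxTrans (ξ.M b).toOplaxTrans).hom.as.naturality g)
  leftUnitor θ := Hom₂.isoMk (fun b c => λ_ (θ.app b c))
    (fun c f => (λ_ (θ.L c).toOplaxTrans).hom.as.naturality f)
    (fun b g => (λ_ (θ.M b).toOplaxTrans).hom.as.naturality g)
  rightUnitor θ := Hom₂.isoMk (fun b c => ρ_ (θ.app b c))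
    (fun c f => (ρ_ (θ.L c).toOplaxTrans).hom.as.naturality f)
    (fun b g => (ρ_ (θ.M b).toOplaxTrans).hom.as.naturality g)
  whiskerLeft_id _ _ := hom₂_ext fun _ _ => Bicategory.whiskerLeft_id _ _
  whiskerLeft_comp _ _ _ _ _ _ := hom₂_ext fun _ _ => Bicategory.whiskerLeft_comp _ _ _
  id_whiskerLeft _ := hom₂_ext fun _ _ => Bicategory.id_whiskerLeft _
  comp_whiskerLeft _ _ _ _ _ := hom₂_ext fun _ _ => Bicategory.comp_whiskerLeft _ _ _
  id_whiskerRight _ _ := hom₂_ext fun _ _ => Bicategory.id_whiskerRight _ _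
  comp_whiskerRight _ _ _ := hom₂_ext fun _ _ => Bicategory.comp_whiskerRight _ _ _
  whiskerRight_id _ := hom₂_ext fun _ _ => Bicategory.whiskerRight_id _
  whiskerRight_comp _ _ _ := hom₂_ext fun _ _ => Bicategory.whiskerRight_comp _ _ _
  whisker_assoc _ _ _ _ _ := hom₂_ext fun _ _ => Bicategory.whisker_assoc _ _ _
  whisker_exchange _ _ := hom₂_ext fun _ _ => Bicategory.whisker_exchange _ _
  pentagon _ _ _ _ := hom₂_ext fun _ _ => Bicategory.pentagon _ _ _ _
  triangle _ _ := hom₂_ext fun _ _ => Bicategory.triangle _ _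


section collate
variable (σ : DistLaw B C D)

/-- The collated bifunctor on 1-morphisms: `M b' g ∘ L c f`. -/
abbrev collateMap {b b' : B} {c c' : C} (f : b ⟶ b') (g : c ⟶ c') : σ.obj b c ⟶ σ.obj b' c' :=
  (σ.L c).map f ≫ (σ.M b').map g

/-- The collated bifunctor on 2-morphisms: the horizontal composite `M b' β * L c α`. -/
abbrev collateMap₂ {b b' : B} {c c' : C} {f f' : b ⟶ b'} {g g' : c ⟶ c'} (α : f ⟶ f') (β : g ⟶ g') :
    σ.collateMap f g ⟶ σ.collateMap f' g' :=
  (σ.L c).map₂ α ▷ (σ.M b').map g ≫ (σ.L c).map f' ◁ (σ.M b').map₂ β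

/-- The unitor of the collated bifunctor: the horizontal composite of the unitors. -/
abbrev collateMapId (b : B) (c : C) : 𝟙 (σ.obj b c) ⟶ σ.collateMap (𝟙 b) (𝟙 c) :=
  (λ_ (𝟙 (σ.obj b c))).inv ≫ (σ.L c).mapId b ▷ 𝟙 (σ.obj b c) ≫ (σ.L c).map (𝟙 b) ◁ (σ.M b).mapId c

/-- The compositor of the collated bifunctor: `dist f' g` followed by the two compositors. -/
abbrev collateMapComp {b b' b'' : B} {c c' c'' : C} (f : b ⟶ b') (g : c ⟶ c') (f' : b' ⟶ b'')
    (g' : c' ⟶ c'') : σ.collateMap f g ≫ σ.collateMap f' g' ⟶ σ.collateMap (f ≫ f') (g ≫ g') :=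
  (α_ _ _ _).hom ≫ (σ.L c).map f ◁ ((α_ _ _ _).inv ≫ σ.dist f' g ▷ (σ.M b'').map g' ≫ (α_ _ _ _).hom) ≫
    (α_ _ _ _).inv ≫ (σ.L c).mapComp f f' ▷ ((σ.M b'').map g ≫ (σ.M b'').map g') ≫
      (σ.L c).map (f ≫ f') ◁ (σ.M b'').mapComp g g'

theorem collate_id {b b' : B} {c c' : C} (f : b ⟶ b') (g : c ⟶ c') :
    σ.collateMap₂ (𝟙 f) (𝟙 g) = 𝟙 (σ.collateMap f g) := by
  dsimp only [collateMap₂, collateMap]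
  simp [LaxFunctorOn.map₂_id]

theorem collate_comp {b b' : B} {c c' : C} {f f' f'' : b ⟶ b'} {g g' g'' : c ⟶ c'}
    (α : f ⟶ f') (β : g ⟶ g') (α' : f' ⟶ f'') (β' : g' ⟶ g'') :
    σ.collateMap₂ (α ≫ α') (β ≫ β') = σ.collateMap₂ α β ≫ σ.collateMap₂ α' β' := by
  dsimp only [collateMap₂, collateMap]
  simp only [LaxFunctorOn.map₂_comp, comp_whiskerRight, Bicategory.whiskerLeft_comp, Category.assoc]
  rw [whisker_exchange_assoc]

theorem collate_natl {b b' b'' : B} {c c' c'' : C} {f₁ f₂ : b ⟶ b'} {g₁ g₂ : c ⟶ c'}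
    (α : f₁ ⟶ f₂) (β : g₁ ⟶ g₂) (f' : b' ⟶ b'') (g' : c' ⟶ c'') :
    σ.collateMapComp f₁ g₁ f' g' ≫ σ.collateMap₂ (α ▷ f') (β ▷ g') =
      σ.collateMap₂ α β ▷ σ.collateMap f' g' ≫ σ.collateMapComp f₂ g₂ f' g' := by
  dsimp only [collateMap₂, collateMap, collateMapComp]
  calc
    _ = 𝟙 _ ⊗≫ (σ.L c).map f₁ ◁ σ.dist f' g₁ ▷ (σ.M b'').map g' ⊗≫
        (((σ.L c).mapComp f₁ f' ≫ (σ.L c).map₂ (α ▷ f')) ▷ ((σ.M b'').map g₁ ≫ (σ.M b'').map g') ≫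
      (σ.L c).map (f₂ ≫ f') ◁ ((σ.M b'').mapComp g₁ g' ≫ (σ.M b'').map₂ (β ▷ g'))) := by
      simp only [comp_whiskerRight, Category.assoc, Bicategory.whiskerLeft_comp]
      rw [whisker_exchange_assoc]
      bicategory
    _ = 𝟙 _ ⊗≫ ((σ.L c).map f₁ ◁ σ.dist f' g₁ ≫ (σ.L c).map₂ α ▷ ((σ.L c).map f' ≫ (σ.M b'').map g₁)) ▷ (σ.M b'').map g' ⊗≫
        (((σ.L c).mapComp f₂ f' ▷ (σ.M b'').map g₁ ≫ (σ.L c).map (f₂ ≫ f') ◁ (σ.M b'').map₂ β)) ▷ (σ.M b'').map g' ⊗≫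
         (σ.L c).map (f₂ ≫ f') ◁ (σ.M b'').mapComp g₂ g' := by
      rw [LaxFunctorOn.mapComp_naturality_left, LaxFunctorOn.mapComp_naturality_left]
      bicategory
    _ = 𝟙 _ ⊗≫ (σ.L c).map₂ α ▷ ((σ.M b').map g₁ ≫ (σ.L c').map f') ▷ (σ.M b'').map g' ⊗≫
        ((σ.L c).map f₂ ◁ (σ.dist f' g₁ ≫ (σ.L c).map f' ◁ (σ.M b'').map₂ β))  ▷ (σ.M b'').map g' ⊗≫
        (σ.L c).mapComp f₂ f' ▷ (σ.M b'').map g₂ ▷ (σ.M b'').map g' ⊗≫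
         (σ.L c).map (f₂ ≫ f') ◁ (σ.M b'').mapComp g₂ g' := by
      rw [whisker_exchange ((σ.L c).map₂ α) (σ.dist f' g₁),
        ← whisker_exchange ((σ.L c).mapComp f₂ f') ((σ.M b'').map₂ β)]
      bicategory
    _ = _ := by
      rw [← σ.dist_M_map₂]
      bicategory

theorem collate_natr {b b' b'' : B} {c c' c'' : C} (f : b ⟶ b') (g : c ⟶ c') {f₁ f₂ : b' ⟶ b''}
    {g₁ g₂ : c' ⟶ c''} (α : f₁ ⟶ f₂) (β : g₁ ⟶ g₂) :
    σ.collateMapComp f g f₁ g₁ ≫ σ.collateMap₂ (f ◁ α) (g ◁ β) =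
      σ.collateMap f g ◁ σ.collateMap₂ α β ≫ σ.collateMapComp f g f₂ g₂ := by
  dsimp only [collateMap₂, collateMap, collateMapComp]
  calc
    _ = 𝟙 _ ⊗≫ (σ.L c).map f ◁ σ.dist f₁ g ▷ (σ.M b'').map g₁ ⊗≫
        (((σ.L c).mapComp f f₁ ≫ (σ.L c).map₂ (f ◁ α)) ▷ ((σ.M b'').map g ≫ (σ.M b'').map g₁) ≫
      (σ.L c).map (f ≫ f₂) ◁ ((σ.M b'').mapComp g g₁ ≫ (σ.M b'').map₂ (g ◁ β))) := by
      simp only [comp_whiskerRight, Category.assoc, Bicategory.whiskerLeft_comp]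
      rw [whisker_exchange_assoc]
      bicategory
    _ = 𝟙 _ ⊗≫ (σ.L c).map f ◁ (σ.dist f₁ g ≫ (σ.L c).map₂ α ▷ (σ.M b'').map g) ▷
          (σ.M b'').map g₁ ⊗≫
        (((σ.L c).mapComp f f₂ ▷ (σ.M b'').map g) ▷ (σ.M b'').map g₁ ≫
          ((σ.L c).map (f ≫ f₂) ≫ (σ.M b'').map g) ◁ (σ.M b'').map₂ β) ⊗≫
         (σ.L c).map (f ≫ f₂) ◁ (σ.M b'').mapComp g g₂ := by
      rw [LaxFunctorOn.mapComp_naturality_right, LaxFunctorOn.mapComp_naturality_right]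
      bicategory
    _ = 𝟙 _ ⊗≫ (σ.L c).map f ◁ (σ.M b').map g ◁ (σ.L c').map₂ α ▷ (σ.M b'').map g₁ ⊗≫
        ((σ.L c).map f ◁ (σ.dist f₂ g ▷ (σ.M b'').map g₁ ≫
          ((σ.L c).map f₂ ≫ (σ.M b'').map g) ◁ (σ.M b'').map₂ β)) ⊗≫
        (σ.L c).mapComp f f₂ ▷ (σ.M b'').map g ▷ (σ.M b'').map g₂ ⊗≫
         (σ.L c).map (f ≫ f₂) ◁ (σ.M b'').mapComp g g₂ := by
      rw [← σ.dist_L_map₂,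
        ← whisker_exchange ((σ.L c).mapComp f f₂ ▷ (σ.M b'').map g) ((σ.M b'').map₂ β)]
      bicategory
    _ = _ := by
      rw [← whisker_exchange]
      bicategory

theorem collate_assoc {b₁ b₂ b₃ b₄ : B} {c₁ c₂ c₃ c₄ : C} (f : b₁ ⟶ b₂) (g : c₁ ⟶ c₂)
    (f' : b₂ ⟶ b₃) (g' : c₂ ⟶ c₃) (f'' : b₃ ⟶ b₄) (g'' : c₃ ⟶ c₄) :
    σ.collateMapComp f g f' g' ▷ σ.collateMap f'' g'' ≫
        σ.collateMapComp (f ≫ f') (g ≫ g') f'' g'' ≫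
          σ.collateMap₂ (α_ f f' f'').hom (α_ g g' g'').hom =
      (α_ _ _ _).hom ≫ σ.collateMap f g ◁ σ.collateMapComp f' g' f'' g'' ≫
        σ.collateMapComp f g (f' ≫ f'') (g' ≫ g'') := by
  dsimp only [collateMap₂, collateMap, collateMapComp]
  have hL := (σ.L c₁).map₂_associator f f' f''
  have hM := (σ.M b₄).map₂_associator g g' g''
  calc
    _ = 𝟙 _ ⊗≫ (σ.L c₁).map f ◁ σ.dist f' g ▷ (σ.M b₃).map g' ▷ ((σ.L c₃).map f'' ≫ (σ.M b₄).map g'') ⊗≫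
       ((σ.L c₁).mapComp f f' ▷ ((σ.M b₃).map g ≫ (σ.M b₃).map g') ≫
        (σ.L c₁).map (f ≫ f') ◁ (σ.M b₃).mapComp g g') ▷ ((σ.L c₃).map f'' ≫ (σ.M b₄).map g'') ⊗≫
        (σ.L c₁).map (f ≫ f') ◁ σ.dist f'' (g ≫ g') ▷ (σ.M b₄).map g'' ⊗≫
        ((σ.L c₁).mapComp (f ≫ f') f'' ≫ (σ.L c₁).map₂ (α_ f f' f'').hom) ▷
          ((σ.M b₄).map (g ≫ g') ≫ (σ.M b₄).map g'') ≫
        (σ.L c₁).map (f ≫ f' ≫ f'') ◁ ((σ.M b₄).mapComp (g ≫ g') g'' ≫ (σ.M b₄).map₂ (α_ g g' g'').hom) := by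
      simp only [comp_whiskerRight, Category.assoc, Bicategory.whiskerLeft_comp]
      rw [whisker_exchange_assoc ((σ.L c₁).map₂ (α_ f f' f'').hom)]
      bicategory
    _ = 𝟙 _ ⊗≫ (σ.L c₁).map f ◁ σ.dist f' g ▷ (σ.M b₃).map g' ▷ ((σ.L c₃).map f'' ≫ (σ.M b₄).map g'') ⊗≫
       (σ.L c₁).mapComp f f' ▷ ((σ.M b₃).map g ≫ (σ.M b₃).map g') ▷ ((σ.L c₃).map f'' ≫ (σ.M b₄).map g'') ⊗≫
        (σ.L c₁).map (f ≫ f') ◁ ((σ.M b₃).mapComp g g' ▷ (σ.L c₃).map f'' ≫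
            σ.dist f'' (g ≫ g')) ▷ (σ.M b₄).map g'' ⊗≫
        ((σ.L c₁).mapComp (f ≫ f') f'' ≫ (σ.L c₁).map₂ (α_ f f' f'').hom) ▷
          ((σ.M b₄).map (g ≫ g') ≫ (σ.M b₄).map g'') ≫
        (σ.L c₁).map (f ≫ f' ≫ f'') ◁ ((σ.M b₄).mapComp (g ≫ g') g'' ≫ (σ.M b₄).map₂ (α_ g g' g'').hom) := by
      bicategory
    _ = 𝟙 _ ⊗≫ (σ.L c₁).map f ◁ σ.dist f' g ▷ (σ.M b₃).map g' ▷ ((σ.L c₃).map f'' ≫ (σ.M b₄).map g'') ⊗≫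
       ((σ.L c₁).mapComp f f' ▷ ((σ.M b₃).map g ≫ (σ.M b₃).map g' ≫ (σ.L c₃).map f'') ≫
        (σ.L c₁).map (f ≫ f') ◁ ((σ.M b₃).map g ◁ σ.dist f'' g' ⊗≫ σ.dist f'' g ▷ (σ.M b₄).map g'))
            ▷ (σ.M b₄).map g'' ⊗≫
        ((((σ.L c₁).map (f ≫ f') ≫ (σ.L c₁).map f'') ◁ (σ.M b₄).mapComp g g' ≫
          ((σ.L c₁).mapComp (f ≫ f') f'' ≫ (σ.L c₁).map₂ (α_ f f' f'').hom) ▷ (σ.M b₄).map (g ≫ g')) ▷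
            (σ.M b₄).map g'') ⊗≫
        (σ.L c₁).map (f ≫ f' ≫ f'') ◁ ((σ.M b₄).mapComp (g ≫ g') g'' ≫ (σ.M b₄).map₂ (α_ g g' g'').hom) := by
      rw [σ.dist_M_comp]
      bicategory
    _ = 𝟙 _ ⊗≫ (σ.L c₁).map f ◁ σ.dist f' g ▷ (σ.M b₃).map g' ▷ ((σ.L c₃).map f'' ≫ (σ.M b₄).map g'') ⊗≫
       (((σ.L c₁).map f ≫ (σ.L c₁).map f') ◁ ((σ.M b₃).map g ◁ σ.dist f'' g' ⊗≫ σ.dist f'' g ▷ (σ.M b₄).map g'))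
            ▷ (σ.M b₄).map g'' ⊗≫
        ((σ.L c₁).mapComp f f' ▷ (σ.L c₁).map f'' ≫ (σ.L c₁).mapComp (f ≫ f') f'' ≫
            (σ.L c₁).map₂ (α_ f f' f'').hom) ▷ ((σ.M b₄).map g ≫ (σ.M b₄).map g') ▷ (σ.M b₄).map g'' ⊗≫
        (σ.L c₁).map (f ≫ f' ≫ f'') ◁ ((σ.M b₄).mapComp g g' ▷ (σ.M b₄).map g'' ≫
          (σ.M b₄).mapComp (g ≫ g') g'' ≫ (σ.M b₄).map₂ (α_ g g' g'').hom) := by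
      rw [whisker_exchange, ← whisker_exchange ((σ.L c₁).mapComp f f')]
      bicategory
    _ = 𝟙 _ ⊗≫ ((σ.L c₁).map f ◁ (σ.dist f' g ▷ ((σ.M b₃).map g' ≫ (σ.L c₃).map f'') ≫
           ((σ.L c₁).map f' ≫ (σ.M b₃).map g) ◁ σ.dist f'' g')) ▷ (σ.M b₄).map g'' ⊗≫
        (((σ.L c₁).map f ≫ (σ.L c₁).map f') ◁ σ.dist f'' g ▷ (σ.M b₄).map g')
            ▷ (σ.M b₄).map g'' ⊗≫
         ((σ.L c₁).map f ◁ (σ.L c₁).mapComp f' f'') ▷ ((σ.M b₄).map g ≫ (σ.M b₄).map g') ▷ (σ.M b₄).map g'' ⊗≫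
        ((σ.L c₁).mapComp f (f' ≫ f'') ▷ ((σ.M b₄).map g ≫ (σ.M b₄).map g' ≫ (σ.M b₄).map g'') ≫
        (σ.L c₁).map (f ≫ f' ≫ f'') ◁ (σ.M b₄).map g ◁ (σ.M b₄).mapComp g' g'') ⊗≫
          (σ.L c₁).map (f ≫ f' ≫ f'') ◁ (σ.M b₄).mapComp g (g' ≫ g'') := by
      rw [hL, hM]
      bicategory
    _ = 𝟙 _ ⊗≫ ((σ.L c₁).map f ◁ (σ.M b₂).map g ◁ (σ.L c₂).map f' ◁ σ.dist f'' g') ▷ (σ.M b₄).map g'' ⊗≫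
        (σ.L c₁).map f ◁ (σ.dist f' g ▷ (σ.L c₂).map f'' ⊗≫ (σ.L c₁).map f' ◁ σ.dist f'' g ⊗≫
          (σ.L c₁).mapComp f' f'' ▷ (σ.M b₄).map g) ▷ ((σ.M b₄).map g' ≫ (σ.M b₄).map g'') ⊗≫
        (((σ.L c₁).map f ≫ (σ.L c₁).map (f' ≫ f'')) ◁ (σ.M b₄).map g ◁ (σ.M b₄).mapComp g' g'' ≫
        (σ.L c₁).mapComp f (f' ≫ f'') ▷ ((σ.M b₄).map g ≫ (σ.M b₄).map (g' ≫ g''))) ⊗≫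
          (σ.L c₁).map (f ≫ f' ≫ f'') ◁ (σ.M b₄).mapComp g (g' ≫ g'') := by
      rw [← whisker_exchange (σ.dist f' g), ← whisker_exchange ((σ.L c₁).mapComp f (f' ≫ f''))]
      bicategory
    _ = 𝟙 _ ⊗≫ ((σ.L c₁).map f ◁ (σ.M b₂).map g ◁ (σ.L c₂).map f' ◁ σ.dist f'' g') ▷ (σ.M b₄).map g'' ⊗≫
        (σ.L c₁).map f ◁ (((σ.M b₂).map g ◁ (σ.L c₂).mapComp f' f'' ≫ σ.dist (f' ≫ f'') g) ▷
          ((σ.M b₄).map g' ≫ (σ.M b₄).map g'') ≫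
         ((σ.L c₁).map (f' ≫ f'') ≫ (σ.M b₄).map g) ◁ (σ.M b₄).mapComp g' g'') ⊗≫
        (σ.L c₁).mapComp f (f' ≫ f'') ▷ ((σ.M b₄).map g ≫ (σ.M b₄).map (g' ≫ g'')) ⊗≫
          (σ.L c₁).map (f ≫ f' ≫ f'') ◁ (σ.M b₄).mapComp g (g' ≫ g'') := by
      rw [σ.dist_L_comp]
      bicategory
    _ = 𝟙 _ ⊗≫ ((σ.L c₁).map f ◁ (σ.M b₂).map g ◁ (σ.L c₂).map f' ◁ σ.dist f'' g') ▷ (σ.M b₄).map g'' ⊗≫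
        (σ.L c₁).map f ◁ (σ.M b₂).map g ◁ ((σ.L c₂).mapComp f' f'' ▷ ((σ.M b₄).map g' ≫ (σ.M b₄).map g'') ≫
          (σ.L c₂).map (f' ≫ f'') ◁ (σ.M b₄).mapComp g' g'') ⊗≫
        (σ.L c₁).map f ◁ σ.dist (f' ≫ f'') g ▷ (σ.M b₄).map (g' ≫ g'') ⊗≫
        (σ.L c₁).mapComp f (f' ≫ f'') ▷ ((σ.M b₄).map g ≫ (σ.M b₄).map (g' ≫ g'')) ⊗≫
          (σ.L c₁).map (f ≫ f' ≫ f'') ◁ (σ.M b₄).mapComp g (g' ≫ g'') := by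
      rw [← whisker_exchange (_ ≫ σ.dist (f' ≫ f'') g),
        ← whisker_exchange ((σ.L c₂).mapComp f' f'')]
      bicategory
    _ = _ := by
      bicategory

theorem collate_left {b₁ b₂ : B} {c₁ c₂ : C} (f : b₁ ⟶ b₂) (g : c₁ ⟶ c₂) :
    σ.collateMap₂ (λ_ f).inv (λ_ g).inv =
      (λ_ _).inv ≫ σ.collateMapId b₁ c₁ ▷ σ.collateMap f g ≫
        σ.collateMapComp (𝟙 b₁) (𝟙 c₁) f g := by
  dsimp only [collateMap₂, collateMap, collateMapComp, collateMapId]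
  rw [LaxFunctorOn.map₂_leftUnitor, LaxFunctorOn.map₂_leftUnitor]
  symm
  calc
    _ = 𝟙 _ ⊗≫ (σ.L c₁).mapId b₁ ▷ ((σ.L c₁).map f ≫ (σ.M b₂).map g) ⊗≫
        (σ.L c₁).map (𝟙 b₁) ◁ ((σ.M b₁).mapId c₁ ▷ (σ.L c₁).map f ≫ σ.dist f (𝟙 c₁)) ▷
          (σ.M b₂).map g ⊗≫
        (σ.L c₁).mapComp (𝟙 b₁) f ▷ ((σ.M b₂).map (𝟙 c₁) ≫ (σ.M b₂).map g) ≫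
        (σ.L c₁).map (𝟙 b₁ ≫ f) ◁ (σ.M b₂).mapComp (𝟙 c₁) g := by
      bicategory
    _ = 𝟙 _ ⊗≫ (σ.L c₁).mapId b₁ ▷ ((σ.L c₁).map f ≫ (σ.M b₂).map g) ⊗≫
        (((σ.L c₁).map (𝟙 b₁) ≫ (σ.L c₁).map f) ◁ ((σ.M b₂).mapId c₁ ▷ (σ.M b₂).map g) ≫
        (σ.L c₁).mapComp (𝟙 b₁) f ▷ ((σ.M b₂).map (𝟙 c₁) ≫ (σ.M b₂).map g)) ⊗≫
        (σ.L c₁).map (𝟙 b₁ ≫ f) ◁ (σ.M b₂).mapComp (𝟙 c₁) g := by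
      rw [σ.dist_M_id]
      bicategory
    _ = _ := by
      rw [whisker_exchange]
      bicategory

theorem collate_right {b₁ b₂ : B} {c₁ c₂ : C} (f : b₁ ⟶ b₂) (g : c₁ ⟶ c₂) :
    σ.collateMap₂ (ρ_ f).inv (ρ_ g).inv =
      (ρ_ _).inv ≫ σ.collateMap f g ◁ σ.collateMapId b₂ c₂ ≫
        σ.collateMapComp f g (𝟙 b₂) (𝟙 c₂) := by
  dsimp only [collateMap₂, collateMap, collateMapComp, collateMapId]
  rw [LaxFunctorOn.map₂_rightUnitor, LaxFunctorOn.map₂_rightUnitor]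
  symm
  calc
    _ = 𝟙 _ ⊗≫ (σ.L c₁).map f ◁ (σ.M b₂).map g ◁ ((σ.L c₂).mapId b₂ ▷ 𝟙 _ ≫
          (σ.L c₂).map (𝟙 b₂) ◁ (σ.M b₂).mapId c₂) ⊗≫
        (σ.L c₁).map f ◁ σ.dist (𝟙 b₂) g ▷ (σ.M b₂).map (𝟙 c₂) ⊗≫
        (σ.L c₁).mapComp f (𝟙 b₂) ▷ ((σ.M b₂).map g ≫ (σ.M b₂).map (𝟙 c₂)) ≫
        (σ.L c₁).map (f ≫ 𝟙 b₂) ◁ (σ.M b₂).mapComp g (𝟙 c₂) := by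
      bicategory
    _ = 𝟙 _ ⊗≫ (σ.L c₁).map f ◁ (((σ.M b₂).map g ≫ 𝟙 _) ◁ (σ.M b₂).mapId c₂ ≫
          ((σ.M b₂).map g ◁ (σ.L c₂).mapId b₂ ≫ σ.dist (𝟙 b₂) g) ▷ (σ.M b₂).map (𝟙 c₂)) ⊗≫
        (σ.L c₁).mapComp f (𝟙 b₂) ▷ ((σ.M b₂).map g ≫ (σ.M b₂).map (𝟙 c₂)) ≫
        (σ.L c₁).map (f ≫ 𝟙 b₂) ◁ (σ.M b₂).mapComp g (𝟙 c₂) := by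
      rw [← whisker_exchange]
      bicategory
    _ = 𝟙 _ ⊗≫ (σ.L c₁).map f ◁ (σ.M b₂).map g ◁ (σ.M b₂).mapId c₂ ⊗≫
        ((σ.L c₁).map f ◁ (σ.L c₁).mapId b₂ ≫ (σ.L c₁).mapComp f (𝟙 b₂)) ▷
          ((σ.M b₂).map g ≫ (σ.M b₂).map (𝟙 c₂)) ⊗≫
        (σ.L c₁).map (f ≫ 𝟙 b₂) ◁ (σ.M b₂).mapComp g (𝟙 c₂) := by
      rw [σ.dist_L_id]
      bicategory
    _ = 𝟙 _ ⊗≫ (((σ.L c₁).map f ≫ 𝟙 (σ.obj b₂ c₁)) ◁ (σ.M b₂).map g ◁ (σ.M b₂).mapId c₂ ≫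
        ((σ.L c₁).map f ◁ (σ.L c₁).mapId b₂ ≫ (σ.L c₁).mapComp f (𝟙 b₂)) ▷
          ((σ.M b₂).map g ≫ (σ.M b₂).map (𝟙 c₂))) ⊗≫
        (σ.L c₁).map (f ≫ 𝟙 b₂) ◁ (σ.M b₂).mapComp g (𝟙 c₂) := by
      bicategory
    _ = _ := by
      rw [whisker_exchange]
      bicategory

/-- The collated lax bifunctor of a distributive law. -/
def collate : B × C ⥤ᴸ D where
  obj x := σ.obj x.1 x.2
  map f := σ.collateMap f.1 f.2
  map₂ η := σ.collateMap₂ η.1 η.2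
  map₂_id f := σ.collate_id f.1 f.2
  map₂_comp η θ := σ.collate_comp η.1 η.2 θ.1 θ.2
  mapId x := σ.collateMapId x.1 x.2
  mapComp f g := σ.collateMapComp f.1 f.2 g.1 g.2
  mapComp_naturality_left η g := σ.collate_natl η.1 η.2 g.1 g.2
  mapComp_naturality_right f _ _ η := σ.collate_natr f.1 f.2 η.1 η.2
  map₂_associator f g h := σ.collate_assoc f.1 f.2 g.1 g.2 h.1 h.2
  map₂_leftUnitor f := σ.collate_left f.1 f.2
  map₂_rightUnitor f := σ.collate_right f.1 f.2

end collate

section collateHom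
variable {σ τ : DistLaw B C D} (θ : Hom σ τ)

/-- The 2-morphism components of the collated oplax transformation: first `M b'` at `g`, then
`L c` at `f`. -/
abbrev Hom.collateNat {b b' : B} {c c' : C} (f : b ⟶ b') (g : c ⟶ c') :
    σ.collateMap f g ≫ θ.app b' c' ⟶ θ.app b c ≫ τ.collateMap f g :=
  (α_ _ _ _).hom ≫ (σ.L c).map f ◁ (θ.M b').naturality g ≫ (α_ _ _ _).inv ≫
    (θ.L c).naturality f ▷ (τ.M b').map g ≫ (α_ _ _ _).hom

theorem Hom.collate_nat {b b' : B} {c c' : C} {f f' : b ⟶ b'} {g g' : c ⟶ c'}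
    (α : f ⟶ f') (β : g ⟶ g') :
    σ.collateMap₂ α β ▷ θ.app b' c' ≫ θ.collateNat f' g' =
      θ.collateNat f g ≫ θ.app b c ◁ τ.collateMap₂ α β := by
  dsimp only [collateMap₂, collateMap, collateNat]
  calc
    _ = 𝟙 _ ⊗≫ (σ.L c).map₂ α ▷ ((σ.M b').map g ≫ θ.app b' c') ⊗≫
      (σ.L c).map f' ◁ ((σ.M b').map₂ β ▷ θ.app b' c' ≫ (θ.M b').naturality g') ⊗≫
      (θ.L c).naturality f' ▷ (τ.M b').map g' ⊗≫ 𝟙 _ := by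
      bicategory
    _ = 𝟙 _ ⊗≫ ((σ.L c).map₂ α ▷ ((σ.M b').map g ≫ θ.app b' c') ≫
      (σ.L c).map f' ◁ (θ.M b').naturality g) ⊗≫
      (((σ.L c).map f' ≫ θ.app b' c) ◁ (τ.M b').map₂ β ≫
      (θ.L c).naturality f' ▷ (τ.M b').map g') ⊗≫ 𝟙 _ := by
      rw [(θ.M b').naturality_naturality]
      bicategory
    _ = 𝟙 _ ⊗≫ (σ.L c).map f ◁ (θ.M b').naturality g ⊗≫
      ((σ.L c).map₂ α ▷ θ.app b' c ≫ (θ.L c).naturality f') ▷ (τ.M b').map g ⊗≫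
        θ.app b c ◁ (τ.L c).map f' ◁ (τ.M b').map₂ β ⊗≫ 𝟙 _ := by
      rw [← whisker_exchange ((σ.L c).map₂ α), whisker_exchange ((θ.L c).naturality f')]
      bicategory
    _ = _ := by
      rw [(θ.L c).naturality_naturality]
      bicategory

theorem Hom.collate_id (b : B) (c : C) :
    σ.collateMapId b c ▷ θ.app b c ≫ θ.collateNat (𝟙 b) (𝟙 c) =
      (λ_ (θ.app b c)).hom ≫ (ρ_ (θ.app b c)).inv ≫ θ.app b c ◁ τ.collateMapId b c := by
  dsimp only [collateMapId, collateMap, collateNat]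
  calc
    _ = 𝟙 _ ⊗≫ (σ.L c).mapId b ▷ θ.app b c ⊗≫
      (σ.L c).map (𝟙 b) ◁ ((σ.M b).mapId c ▷ θ.app b c ≫ (θ.M b).naturality (𝟙 c)) ⊗≫
      (θ.L c).naturality (𝟙 b) ▷ (τ.M b).map (𝟙 c) ⊗≫ 𝟙 _ := by
      bicategory
    _ = 𝟙 _ ⊗≫ (σ.L c).mapId b ▷ θ.app b c ⊗≫
      (((σ.L c).map (𝟙 b) ≫ θ.app b c) ◁ (τ.M b).mapId c ≫
      (θ.L c).naturality (𝟙 b) ▷ (τ.M b).map (𝟙 c)) ⊗≫ 𝟙 _ := by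
      rw [(θ.M b).naturality_id]
      bicategory
    _ = 𝟙 _ ⊗≫ ((σ.L c).mapId b ▷ θ.app b c ≫ (θ.L c).naturality (𝟙 b)) ⊗≫
        θ.app b c ◁ (τ.L c).map (𝟙 b) ◁ (τ.M b).mapId c ⊗≫ 𝟙 _ := by
      rw [whisker_exchange]
      bicategory
    _ = _ := by
      rw [(θ.L c).naturality_id]
      bicategory

theorem Hom.collate_comp {b b' b'' : B} {c c' c'' : C} (f : b ⟶ b') (g : c ⟶ c')
    (f' : b' ⟶ b'') (g' : c' ⟶ c'') :
    σ.collateMapComp f g f' g' ▷ θ.app b'' c'' ≫ θ.collateNat (f ≫ f') (g ≫ g') =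
      (α_ _ _ _).hom ≫ σ.collateMap f g ◁ θ.collateNat f' g' ≫
        (α_ _ _ _).inv ≫ θ.collateNat f g ▷ τ.collateMap f' g' ≫ (α_ _ _ _).hom ≫
          θ.app b c ◁ τ.collateMapComp f g f' g' := by
  dsimp only [collateMapComp, collateMap, collateNat]
  calc
    _ = 𝟙 _ ⊗≫ (σ.L c).map f ◁ σ.dist f' g ▷ (σ.M b'').map g' ▷ θ.app b'' c'' ⊗≫
      (σ.L c).mapComp f f' ▷ ((σ.M b'').map g ≫ (σ.M b'').map g') ▷ θ.app b'' c'' ⊗≫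
      (σ.L c).map (f ≫ f') ◁ ((σ.M b'').mapComp g g' ▷ θ.app b'' c'' ≫
        (θ.M b'').naturality (g ≫ g')) ⊗≫
      (θ.L c).naturality (f ≫ f') ▷ (τ.M b'').map (g ≫ g') ⊗≫ 𝟙 _ := by
      bicategory
    _ = 𝟙 _ ⊗≫ (σ.L c).map f ◁ σ.dist f' g ▷ (σ.M b'').map g' ▷ θ.app b'' c'' ⊗≫
      ((σ.L c).mapComp f f' ▷ ((σ.M b'').map g ≫ (σ.M b'').map g' ≫ θ.app b'' c'') ≫
      (σ.L c).map (f ≫ f') ◁ ((σ.M b'').map g ◁ (θ.M b'').naturality g' ⊗≫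
        (θ.M b'').naturality g ▷ (τ.M b'').map g')) ⊗≫
      (((σ.L c).map (f ≫ f') ≫ θ.app b'' c) ◁ (τ.M b'').mapComp g g' ≫
      (θ.L c).naturality (f ≫ f') ▷ (τ.M b'').map (g ≫ g')) ⊗≫ 𝟙 _ := by
      rw [(θ.M b'').naturality_comp]
      bicategory
    _ = 𝟙 _ ⊗≫ (σ.L c).map f ◁ (σ.dist f' g ▷ ((σ.M b'').map g' ≫ θ.app b'' c'') ≫
          ((σ.L c).map f' ≫ (σ.M b'').map g) ◁ (θ.M b'').naturality g') ⊗≫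
        ((σ.L c).map f ≫ (σ.L c).map f') ◁ (θ.M b'').naturality g ▷ (τ.M b'').map g' ⊗≫
        ((σ.L c).mapComp f f' ▷ θ.app b'' c ≫ (θ.L c).naturality (f ≫ f')) ▷
          ((τ.M b'').map g ≫ (τ.M b'').map g') ⊗≫
        (θ.app b c ≫ (τ.L c).map (f ≫ f')) ◁ (τ.M b'').mapComp g g' ⊗≫ 𝟙 _ := by
      rw [← whisker_exchange ((σ.L c).mapComp f f'), whisker_exchange ((θ.L c).naturality (f ≫ f'))]
      bicategory
    _ = 𝟙 _ ⊗≫ (σ.L c).map f ◁ (σ.M b').map g ◁ (σ.L c').map f' ◁ (θ.M b'').naturality g' ⊗≫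
        (σ.L c).map f ◁ (σ.dist f' g ▷ θ.app b'' c' ≫ (α_ _ _ _).hom ≫
          (σ.L c).map f' ◁ (θ.M b'').naturality g ≫ (α_ _ _ _).inv ≫
          (θ.L c).naturality f' ▷ (τ.M b'').map g ≫ (α_ _ _ _).hom) ▷ (τ.M b'').map g' ⊗≫
        (θ.L c).naturality f ▷ (τ.L c).map f' ▷ ((τ.M b'').map g ≫ (τ.M b'').map g') ⊗≫
        θ.app b c ◁ (τ.L c).mapComp f f' ▷ ((τ.M b'').map g ≫ (τ.M b'').map g') ⊗≫
        (θ.app b c ≫ (τ.L c).map (f ≫ f')) ◁ (τ.M b'').mapComp g g' ⊗≫ 𝟙 _ := by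
      rw [(θ.L c).naturality_comp, ← whisker_exchange (σ.dist f' g)]
      bicategory
    _ = 𝟙 _ ⊗≫ (σ.L c).map f ◁ (σ.M b').map g ◁ (σ.L c').map f' ◁ (θ.M b'').naturality g' ⊗≫
        (σ.L c).map f ◁ ((σ.M b').map g ◁ (θ.L c').naturality f' ⊗≫
          (θ.M b').naturality g ▷ (τ.L c').map f') ▷ (τ.M b'').map g' ⊗≫
        (((σ.L c).map f ≫ θ.app b' c) ◁ τ.dist f' g ≫
        (θ.L c).naturality f ▷ ((τ.L c).map f' ≫ (τ.M b'').map g)) ▷ (τ.M b'').map g' ⊗≫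
        θ.app b c ◁ (τ.L c).mapComp f f' ▷ ((τ.M b'').map g ≫ (τ.M b'').map g') ⊗≫
        (θ.app b c ≫ (τ.L c).map (f ≫ f')) ◁ (τ.M b'').mapComp g g' ⊗≫ 𝟙 _ := by
      rw [θ.yang_baxter]
      bicategory
    _ = 𝟙 _ ⊗≫ (σ.L c).map f ◁ (σ.M b').map g ◁ (σ.L c').map f' ◁ (θ.M b'').naturality g' ⊗≫
        (σ.L c).map f ◁ (σ.M b').map g ◁ (θ.L c').naturality f' ▷ (τ.M b'').map g' ⊗≫
        (σ.L c).map f ◁ (θ.M b').naturality g ▷ ((τ.L c').map f' ≫ (τ.M b'').map g') ⊗≫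
        (θ.L c).naturality f ▷ (τ.M b').map g ▷ ((τ.L c').map f' ≫ (τ.M b'').map g') ⊗≫
        θ.app b c ◁ (τ.L c).map f ◁ τ.dist f' g ▷ (τ.M b'').map g' ⊗≫
        θ.app b c ◁ (τ.L c).mapComp f f' ▷ ((τ.M b'').map g ≫ (τ.M b'').map g') ⊗≫
        (θ.app b c ≫ (τ.L c).map (f ≫ f')) ◁ (τ.M b'').mapComp g g' ⊗≫ 𝟙 _ := by
      rw [whisker_exchange ((θ.L c).naturality f)]
      bicategory
    _ = _ := by
      bicategory

/-- The collated oplax transformation of a morphism of distributive laws. -/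
def Hom.collate : σ.collate ⟶ τ.collate :=
  Lax.OplaxTrans.mk (F := σ.collate) (G := τ.collate)
    (fun x => θ.app x.1 x.2) (fun f => θ.collateNat f.1 f.2)
    (fun η => θ.collate_nat η.1 η.2) (fun x => θ.collate_id x.1 x.2)
    (fun f g => θ.collate_comp f.1 f.2 g.1 g.2)

variable {θ} {ζ : Hom σ τ} (Γ : Hom₂ θ ζ)

theorem Hom₂.collate_naturality {b b' : B} {c c' : C} (f : b ⟶ b') (g : c ⟶ c') :
    σ.collateMap f g ◁ Γ.app b' c' ≫ ζ.collateNat f g =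
      θ.collateNat f g ≫ Γ.app b c ▷ τ.collateMap f g := by
  dsimp only [collateMap, Hom.collateNat]
  calc
    _ = 𝟙 _ ⊗≫ (σ.L c).map f ◁ ((σ.M b').map g ◁ Γ.app b' c' ≫ (ζ.M b').naturality g) ⊗≫
      (ζ.L c).naturality f ▷ (τ.M b').map g ⊗≫ 𝟙 _ := by
      bicategory
    _ = 𝟙 _ ⊗≫ (σ.L c).map f ◁ (θ.M b').naturality g ⊗≫
      ((σ.L c).map f ◁ Γ.app b' c ≫ (ζ.L c).naturality f) ▷ (τ.M b').map g ⊗≫ 𝟙 _ := by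
      rw [Γ.naturality_M]
      bicategory
    _ = _ := by
      rw [Γ.naturality_L]
      bicategory

/-- The collated modification of a 2-morphism of distributive laws. -/
def Hom₂.collate : θ.collate ⟶ ζ.collate :=
  ⟨⟨fun x => Γ.app x.1 x.2, fun f => Γ.collate_naturality f.1 f.2⟩⟩

end collateHom

/-- The modification between iterated oplax transformations that corresponds to a 2-morphism of
distributive laws. -/
def Hom₂.toIterated {σ τ : DistLaw B C D} {θ ζ : Hom σ τ} (Γ : Hom₂ θ ζ) :
    θ.toIterated ⟶ ζ.toIterated :=
  ⟨⟨fun b => Γ.toM b, fun f => by ext c; exact Γ.naturality_L c f⟩⟩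


end DistLaw

section Iterated
variable {B : Type u₁} [Bicategory.{w₁, v₁} B] {C : Type u₂} [Bicategory.{w₂, v₂} C]
    {D : Type u₃} [Bicategory.{w₃, v₃} D]

/-- A lax functor, regarded as a lax functor with its own action on objects. -/
def LaxFunctorOn.ofLaxFunctor (F : C ⥤ᴸ D) : LaxFunctorOn C D F.obj where
  map := F.map
  map₂ := F.map₂
  map₂_id := F.map₂_id
  map₂_comp := F.map₂_comp
  mapId := F.mapId
  mapComp := F.mapComp
  mapComp_naturality_left := F.mapComp_naturality_left
  mapComp_naturality_right := F.mapComp_naturality_right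
  map₂_associator := F.map₂_associator
  map₂_leftUnitor := F.map₂_leftUnitor
  map₂_rightUnitor := F.map₂_rightUnitor

open LaxFunctorOn

/-- An oplax transformation, regarded as one with prescribed components. -/
def OplaxTransOn.ofOplaxTrans {F G : C ⥤ᴸ D} (θ : F ⟶ G) :
    OplaxTransOn (ofLaxFunctor F) (ofLaxFunctor G) θ.app where
  naturality := θ.naturality
  naturality_naturality := θ.naturality_naturality
  naturality_id := θ.naturality_id
  naturality_comp := θ.naturality_comp

/-- Evaluation of an iterated lax functor at an object `c`. -/
def LaxFunctorOn.eval (Q : B ⥤ᴸ (C ⥤ᴸ D)) (c : C) :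
    LaxFunctorOn B D (fun b => (Q.obj b).obj c) where
  map f := (Q.map f).app c
  map₂ α := (Q.map₂ α).as.app c
  map₂_id f := congrArg (fun Γ => Γ.as.app c) (Q.map₂_id f)
  map₂_comp α β := congrArg (fun Γ => Γ.as.app c) (Q.map₂_comp α β)
  mapId b := (Q.mapId b).as.app c
  mapComp f g := (Q.mapComp f g).as.app c
  mapComp_naturality_left α g := congrArg (fun Γ => Γ.as.app c) (Q.mapComp_naturality_left α g)
  mapComp_naturality_right f _ _ α := congrArg (fun Γ => Γ.as.app c) (Q.mapComp_naturality_right f α)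
  map₂_associator f g h := congrArg (fun Γ => Γ.as.app c) (Q.map₂_associator f g h)
  map₂_leftUnitor f := congrArg (fun Γ => Γ.as.app c) (Q.map₂_leftUnitor f)
  map₂_rightUnitor f := congrArg (fun Γ => Γ.as.app c) (Q.map₂_rightUnitor f)

/-- Evaluation of a transformation of iterated lax functors at an object `c`. -/
def OplaxTransOn.eval {Q R : B ⥤ᴸ (C ⥤ᴸ D)} (θ : Q ⟶ R) (c : C) :
    OplaxTransOn (LaxFunctorOn.eval Q c) (LaxFunctorOn.eval R c) (fun b => (θ.app b).app c) where
  naturality f := (θ.naturality f).as.app c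
  naturality_naturality α := congrArg (fun Γ => Γ.as.app c) (θ.naturality_naturality α)
  naturality_id b := congrArg (fun Γ => Γ.as.app c) (θ.naturality_id b)
  naturality_comp f g := congrArg (fun Γ => Γ.as.app c) (θ.naturality_comp f g)

namespace DistLaw

/-- The distributive law extracted from an iterated lax functor `Q`: `M b = Q b`, `L c` is the
evaluation of `Q` at `c`, and `dist f g` is the 2-morphism of `Q f` at `g`. -/
def ofIterated (Q : B ⥤ᴸ (C ⥤ᴸ D)) : DistLaw B C D where
  obj b c := (Q.obj b).obj c
  L c := LaxFunctorOn.eval Q c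
  M b := LaxFunctorOn.ofLaxFunctor (Q.obj b)
  dist f g := (Q.map f).naturality g
  dist_M_comp f g g' := (Q.map f).naturality_comp g g'
  dist_M_id c f := (Q.map f).naturality_id c
  dist_M_map₂ f _ _ β := (Q.map f).naturality_naturality β
  dist_L_comp f f' g := ((Q.mapComp f f').as.naturality g).trans (comp_assoc₆ _ _ _ _ _ _).symm
  dist_L_id b g := ((Q.mapId b).as.naturality g).trans (Category.assoc _ _ _)
  dist_L_map₂ α g := (Q.map₂ α).as.naturality g

/-- The morphism of distributive laws extracted from an iterated oplax transformation. -/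
def Hom.ofIterated {Q R : B ⥤ᴸ (C ⥤ᴸ D)} (θ : Q ⟶ R) : Hom (ofIterated Q) (ofIterated R) where
  app b c := (θ.app b).app c
  L c := OplaxTransOn.eval θ c
  M b := OplaxTransOn.ofOplaxTrans (θ.app b)
  yang_baxter f g := (yang_baxter_iff (σ := DistLaw.ofIterated Q) (τ := DistLaw.ofIterated R)
    (OplaxTransOn.eval θ) (fun b => OplaxTransOn.ofOplaxTrans (θ.app b)) f g).2
      ((θ.naturality f).as.naturality g)

/-- The 2-morphism of distributive laws extracted from an iterated modification. -/
def Hom₂.ofIterated {Q R : B ⥤ᴸ (C ⥤ᴸ D)} {θ ζ : Q ⟶ R} (Γ : θ ⟶ ζ) :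
    Hom₂ (Hom.ofIterated θ) (Hom.ofIterated ζ) where
  app b c := (Γ.as.app b).as.app c
  naturality_L c f := congrArg (fun Γ => Γ.as.app c) (Γ.as.naturality f)
  naturality_M b g := (Γ.as.app b).as.naturality g

variable (B C D)

/-- Collation of distributive laws, of their morphisms and of their 2-morphisms. -/
def collation : PrelaxFunctorStruct (DistLaw B C D) (B × C ⥤ᴸ D) where
  obj σ := σ.collate
  map θ := Hom.collate θ
  map₂ Γ := Hom₂.collate Γ

/-- The assignment of iterated lax functors, oplax transformations and modifications to distributive
laws, their morphisms and their 2-morphisms. -/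
def iteration : PrelaxFunctorStruct (DistLaw B C D) (B ⥤ᴸ (C ⥤ᴸ D)) where
  obj σ := σ.toIterated
  map θ := Hom.toIterated θ
  map₂ Γ := Hom₂.toIterated Γ

/-- The assignment of distributive laws, their morphisms and their 2-morphisms to iterated lax
functors, oplax transformations and modifications. -/
def deiteration : PrelaxFunctorStruct (B ⥤ᴸ (C ⥤ᴸ D)) (DistLaw B C D) where
  obj Q := ofIterated Q
  map θ := Hom.ofIterated θ
  map₂ Γ := Hom₂.ofIterated Γ

end DistLaw

/-- Uncurrying of a lax functor `Q` from `B` to the 2-category of lax functors `C → D`: the value at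
`(f, g)` is `(Q f)` at the source object of `g`, followed by the value at `g` of `Q` of the target
of `f`; the compositor uses the naturality 2-morphisms of the oplax transformations `Q f`. -/
def uncurryObj (Q : B ⥤ᴸ (C ⥤ᴸ D)) : B × C ⥤ᴸ D where
  obj x := (Q.obj x.1).obj x.2
  map {x _} f := (Q.map f.1).app x.2 ≫ (Q.obj _).map f.2
  map₂ {x y f g} η := (Q.map₂ η.1).as.app x.2 ▷ (Q.obj y.1).map f.2 ≫
    (Q.map g.1).app x.2 ◁ (Q.obj y.1).map₂ η.2
  mapId x := (λ_ (𝟙 _)).inv ≫ (Q.mapId x.1).as.app x.2 ▷ 𝟙 _ ≫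
    (Q.map (𝟙 x.1)).app x.2 ◁ (Q.obj x.1).mapId x.2
  mapComp {x _ z} f g := (α_ _ _ _).hom ≫ (Q.map f.1).app x.2 ◁ ((α_ _ _ _).inv ≫
      (Q.map g.1).naturality f.2 ▷ (Q.obj z.1).map g.2 ≫ (α_ _ _ _).hom) ≫ (α_ _ _ _).inv ≫
        (Q.mapComp f.1 g.1).as.app x.2 ▷ ((Q.obj z.1).map f.2 ≫ (Q.obj z.1).map g.2) ≫
          (Q.map (f.1 ≫ g.1)).app x.2 ◁ (Q.obj z.1).mapComp f.2 g.2
  map₂_id := (DistLaw.ofIterated Q).collate.map₂_id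
  map₂_comp := (DistLaw.ofIterated Q).collate.map₂_comp
  mapComp_naturality_left := (DistLaw.ofIterated Q).collate.mapComp_naturality_left
  mapComp_naturality_right := (DistLaw.ofIterated Q).collate.mapComp_naturality_right
  map₂_associator := (DistLaw.ofIterated Q).collate.map₂_associator
  map₂_leftUnitor := (DistLaw.ofIterated Q).collate.map₂_leftUnitor
  map₂_rightUnitor f := (DistLaw.ofIterated Q).collate.map₂_rightUnitor f

/-- Uncurrying of an oplax transformation. -/
def uncurryMap {Q R : B ⥤ᴸ (C ⥤ᴸ D)} (θ : Q ⟶ R) : uncurryObj Q ⟶ uncurryObj R :=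
  Lax.OplaxTrans.mk (F := uncurryObj Q) (G := uncurryObj R)
    (fun x => (θ.app x.1).app x.2)
    (fun {x y} f => (α_ _ _ _).hom ≫ (Q.map f.1).app x.2 ◁ (θ.app y.1).naturality f.2 ≫
      (α_ _ _ _).inv ≫ (θ.naturality f.1).as.app x.2 ▷ (R.obj y.1).map f.2 ≫ (α_ _ _ _).hom)
    (fun η => (DistLaw.Hom.ofIterated θ).collate.naturality_naturality η)
    (fun x => (DistLaw.Hom.ofIterated θ).collate.naturality_id x)
    (fun f g => (DistLaw.Hom.ofIterated θ).collate.naturality_comp f g)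

/-- Uncurrying of a modification. -/
def uncurryMap₂ {Q R : B ⥤ᴸ (C ⥤ᴸ D)} {θ ζ : Q ⟶ R} (Γ : θ ⟶ ζ) :
    uncurryMap θ ⟶ uncurryMap ζ :=
  ⟨⟨fun x => (Γ.as.app x.1).as.app x.2, (DistLaw.Hom₂.ofIterated Γ).collate.as.naturality⟩⟩

variable (B C D)
/-- Uncurrying of iterated lax functors, oplax transformations and modifications. -/
def uncurrying : PrelaxFunctorStruct (B ⥤ᴸ (C ⥤ᴸ D)) (B × C ⥤ᴸ D) where
  obj Q := uncurryObj Q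
  map θ := uncurryMap θ
  map₂ Γ := uncurryMap₂ Γ

end Iterated

theorem laxExt {B : Type u₁} [Bicategory.{w₁, v₁} B] {D : Type u₂} [Bicategory.{w₂, v₂} D]
   {F G : B ⥤ᴸ D} (θ ζ : F ⟶ G) (Γ : θ ≅ ζ) (h : ∀ a, θ.app a = ζ.app a)
    (h' : ∀ a, Γ.hom.as.app a = eqToHom (h a)) : ∃ h : θ = ζ, Γ = eqToIso h := by
  have key : θ = ζ := by
    have nat := fun {a b : B} (f : a ⟶ b) => Γ.hom.as.naturality f
    simp only [h'] at nat
    clear h' Γ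
    obtain ⟨app, n, _, _, _⟩ := θ
    obtain ⟨app', n', _, _, _⟩ := ζ
    obtain rfl : app = app' := funext h
    have : @n = @n' := by
      funext a b f
      simpa using (nat f).symm
    subst this
    rfl
  subst key
  refine ⟨rfl, ?_⟩
  ext a
  simpa using h' a

/-- Lax functors into a strict 2-category, oplax transformations and modifications form a strict
2-category. -/
instance strictLax {B : Type u₁} [Bicategory.{w₁, v₁} B] {D : Type u₂} [Bicategory.{w₂, v₂} D]
    [Strict D] : Strict (B ⥤ᴸ D) where
  id_comp θ := (laxExt _ _ (λ_ θ) (fun _ => Strict.id_comp _) (fun _ => congrArg Iso.hom (Strict.leftUnitor_eqToIso _))).1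
  comp_id θ := (laxExt _ _ (ρ_ θ) (fun _ => Strict.comp_id _) (fun _ => congrArg Iso.hom (Strict.rightUnitor_eqToIso _))).1
  assoc θ ζ ξ := (laxExt _ _ (α_ θ ζ ξ) (fun _ => Strict.assoc _ _ _) (fun _ => congrArg Iso.hom (Strict.associator_eqToIso _ _ _))).1
  leftUnitor_eqToIso θ := (laxExt _ _ (λ_ θ) (fun _ => Strict.id_comp _) (fun _ => congrArg Iso.hom (Strict.leftUnitor_eqToIso _))).2
  rightUnitor_eqToIso θ := (laxExt _ _ (ρ_ θ) (fun _ => Strict.comp_id _) (fun _ => congrArg Iso.hom (Strict.rightUnitor_eqToIso _))).2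
  associator_eqToIso θ ζ ξ := (laxExt _ _ (α_ θ ζ ξ) (fun _ => Strict.assoc _ _ _) (fun _ => congrArg Iso.hom (Strict.associator_eqToIso _ _ _))).2

theorem distExt {B : Type u₁} [Bicategory.{w₁, v₁} B] {C : Type u₂} [Bicategory.{w₂, v₂} C]
    {D : Type u₃} [Bicategory.{w₃, v₃} D] {σ τ : DistLaw B C D} (θ ζ : σ ⟶ τ) (Γ : θ ≅ ζ)
    (h : ∀ b c, DistLaw.Hom.app θ b c = DistLaw.Hom.app ζ b c)
    (h' : ∀ b c, DistLaw.Hom₂.app Γ.hom b c = eqToHom (h b c)) : ∃ h : θ = ζ, Γ = eqToIso h := by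
  have key : θ = ζ := by
    have natL := fun {b b' : B} (c : C) (f : b ⟶ b') => DistLaw.Hom₂.naturality_L Γ.hom c f
    have natM := fun {c c' : C} (b : B) (g : c ⟶ c') => DistLaw.Hom₂.naturality_M Γ.hom b g
    simp only [h'] at natL natM
    clear h' Γ
    obtain ⟨app, L, M, _⟩ := θ
    obtain ⟨app', L', M', _⟩ := ζ
    obtain rfl : app = app' := by funext b c; exact h b c
    have eL : L = L' := by
      funext c
      have := fun {b b' : B} (f : b ⟶ b') => natL c f
      revert this
      dsimp only
      generalize L c = l
      generalize L' c = l'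
      intro this
      obtain ⟨n, _, _, _⟩ := l
      obtain ⟨n', _, _, _⟩ := l'
      have : @n = @n' := by
        funext a b f
        simpa using (this f).symm
      subst this
      rfl
    have eM : M = M' := by
      funext c
      have := fun {b b' : C} (f : b ⟶ b') => natM c f
      revert this
      dsimp only
      generalize M c = l
      generalize M' c = l'
      intro this
      obtain ⟨n, _, _, _⟩ := l
      obtain ⟨n', _, _, _⟩ := l'
      have : @n = @n' := by
        funext a b f
        simpa using (this f).symm
      subst this
      rfl
    subst eL eM
    rfl
  subst key
  refine ⟨rfl, ?_⟩
  ext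
  apply DistLaw.hom₂_ext
  intro b c
  exact h' b c

namespace DistLaw
/-- Distributive laws in a strict 2-category form a strict 2-category. -/
instance strict {B : Type u₁} [Bicategory.{w₁, v₁} B] {C : Type u₂} [Bicategory.{w₂, v₂} C]
    {D : Type u₃} [Bicategory.{w₃, v₃} D] [Strict D] : Strict (DistLaw B C D) where
  id_comp θ := (distExt _ _ (λ_ θ) (fun _ _ => Strict.id_comp _) (fun _ _ => congrArg Iso.hom (Strict.leftUnitor_eqToIso _))).1
  comp_id θ := (distExt _ _ (ρ_ θ) (fun _ _ => Strict.comp_id _) (fun _ _ => congrArg Iso.hom (Strict.rightUnitor_eqToIso _))).1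
  assoc θ ζ ξ := (distExt _ _ (α_ θ ζ ξ) (fun _ _ => Strict.assoc _ _ _) (fun _ _ => congrArg Iso.hom (Strict.associator_eqToIso _ _ _))).1
  leftUnitor_eqToIso θ := (distExt _ _ (λ_ θ) (fun _ _ => Strict.id_comp _) (fun _ _ => congrArg Iso.hom (Strict.leftUnitor_eqToIso _))).2
  rightUnitor_eqToIso θ := (distExt _ _ (ρ_ θ) (fun _ _ => Strict.comp_id _) (fun _ _ => congrArg Iso.hom (Strict.rightUnitor_eqToIso _))).2
  associator_eqToIso θ ζ ξ := (distExt _ _ (α_ θ ζ ξ) (fun _ _ => Strict.assoc _ _ _) (fun _ _ => congrArg Iso.hom (Strict.associator_eqToIso _ _ _))).2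
end DistLaw

/-! A distributive law is a lax functor `Q` from `B` to the 2-category of lax functors `C ⥤ᴸ D`,
written out in components. The oplax transformation axioms for `Q f` are the compatibilities of
`dist` with the compositors, unitors and 2-morphisms on the `M` side. The modification axioms for
the compositors, unitors and 2-morphisms of `Q` are the same compatibilities on the `L` side. The
remaining axioms of `Q` are equations of modifications, so they hold at each object `c` separately
and say that each `L c` is lax. One level up, the Yang–Baxter equation is the modification axiom for
the 2-morphism components of an iterated transformation, up to moving associators across
(`yang_baxter_iff`). Hence `iteration` and `deiteration` regroup the same data and are mutually
inverse.

What is left for collation, once its values are known to be lax functors, transformations and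
modifications, is functoriality. Vertical composition of 2-morphisms is componentwise on both sides.
On 1-morphisms, `collateNat_id` is pure coherence. In `collateNat_comp` the two sides differ only in
the order of two middle 2-morphisms acting on independent factors, so the interchange law suffices.
The Yang–Baxter equation is needed earlier, in `Hom.collate_comp`, for compatibility with
compositors.

Uncurrying needs no separate verification: on data it is `deiteration` followed by `collation`, so
`J` is the composite of `Ψ` and `K`. A strict 2-functor is determined by its data
(`ext_of_toPrelaxFunctorStruct`), so every equation between 2-functors reduces to one between
assignments on objects, 1-morphisms and 2-morphisms. -/

/-! ### Strict 2-functors are determined by their data. -/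

namespace CategoryTheory.StrictPseudofunctor

variable {X : Type u₁} [Bicategory.{w₁, v₁} X] {Y : Type u₂} [Bicategory.{w₂, v₂} Y]

/-- A strict pseudofunctor is determined by its action on objects, 1-morphisms and 2-morphisms. -/
theorem ext_of_toPrelaxFunctorStruct {F G : StrictPseudofunctor X Y}
    (h : F.toPrelaxFunctorStruct = G.toPrelaxFunctorStruct) : F = G := by
  obtain ⟨⟨⟨⟨S, _, _⟩, mapId, mapComp, _, _, _, _, _⟩, map_id, hId⟩, map_comp, hComp⟩ := F
  obtain ⟨⟨⟨⟨T, _, _⟩, mapId', mapComp', _, _, _, _, _⟩, map_id', hId'⟩, map_comp', hComp'⟩ := G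
  obtain rfl : S = T := h
  -- Strictness forces the unit and composition isomorphisms to be the `eqToIso` of equations
  -- between 1-morphisms, and such equations are proof-irrelevant.
  obtain rfl : mapId = mapId' := by
    funext a
    exact (hId a).trans (hId' a).symm
  obtain rfl : @mapComp = @mapComp' := by
    funext a b c f g
    exact (hComp f g).trans (hComp' f g).symm
  rfl

end CategoryTheory.StrictPseudofunctor

/-! ### Componentwise equality of oplax transformations and modifications. -/

namespace CategoryTheory.Lax.OplaxTrans

variable {X : Type u₁} [Bicategory.{w₁, v₁} X] {Y : Type u₂} [Bicategory.{w₂, v₂} Y] {F G : X ⥤ᴸ Y}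

/-- Modifications between equal oplax transformations agree if their components do. -/
theorem eq_eqToHom_comp_comp {θ θ' ζ ζ' : F ⟶ G} (h : θ = θ') (h' : ζ' = ζ) {Γ : θ ⟶ ζ}
    {Λ : θ' ⟶ ζ'} (hΓ : ∀ a, HEq (Γ.as.app a) (Λ.as.app a)) :
    Γ = eqToHom h ≫ Λ ≫ eqToHom h' := by
  subst h h'
  rw [eqToHom_refl, eqToHom_refl, Category.id_comp, Category.comp_id]
  exact homCategory.ext fun a => eq_of_heq (hΓ a)

/-- Oplax transformations with the same components are equal if their 2-morphisms are. -/
theorem mk_congr (app : ∀ a, F.obj a ⟶ G.obj a)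
    {n n' : ∀ {a b : X} (f : a ⟶ b), F.map f ≫ app b ⟶ app a ≫ G.map f} {h₁ h₂ h₃ h₁' h₂' h₃'}
    (h : ∀ {a b : X} (f : a ⟶ b), n f = n' f) :
    Lax.OplaxTrans.mk (F := F) (G := G) app n h₁ h₂ h₃ =
      Lax.OplaxTrans.mk (F := F) (G := G) app n' h₁' h₂' h₃' := by
  obtain rfl : @n = @n' := by
    funext a b f
    exact h f
  rfl

end CategoryTheory.Lax.OplaxTrans

/-! ### Underlying data of composites and identities. -/

namespace CategoryTheory.StrictPseudofunctor

variable {X : Type u₁} [Bicategory.{w₁, v₁} X] {Y : Type u₂} [Bicategory.{w₂, v₂} Y]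
  {Z : Type u₃} [Bicategory.{w₃, v₃} Z]

theorem comp_toPrelaxFunctorStruct (F : StrictPseudofunctor X Y) (G : StrictPseudofunctor Y Z) :
    (F.comp G).toPrelaxFunctorStruct = F.toPrelaxFunctorStruct.comp G.toPrelaxFunctorStruct :=
  rfl

theorem id_toPrelaxFunctorStruct :
    (StrictPseudofunctor.id X).toPrelaxFunctorStruct = PrelaxFunctorStruct.id X :=
  rfl

end CategoryTheory.StrictPseudofunctor

/-- Heterogeneous equality is needed because `S.map f` and `f` share a type only after the objects
have been identified, and likewise for 2-morphisms. Substituting level by level turns each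
hypothesis into an ordinary equation. -/
theorem CategoryTheory.PrelaxFunctorStruct.eq_id {X : Type u₁} [Bicategory.{w₁, v₁} X]
    {S : PrelaxFunctorStruct X X} (h₀ : ∀ x, S.obj x = x)
    (h₁ : ∀ {x y : X} (f : x ⟶ y), HEq (S.map f) f)
    (h₂ : ∀ {x y : X} {f g : x ⟶ y} (η : f ⟶ g), HEq (S.map₂ η) η) :
    S = PrelaxFunctorStruct.id X := by
  obtain ⟨⟨obj, map⟩, map₂⟩ := S
  obtain rfl : obj = fun x => x := funext h₀
  obtain rfl : @map = fun _ _ f => f := by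
    funext x y f
    exact eq_of_heq (h₁ f)
  obtain rfl : @map₂ = fun _ _ _ _ η => η := by
    funext x y f g η
    exact eq_of_heq (h₂ η)
  rfl

/-! ### Comparison across equal lax functors. -/

namespace CategoryTheory.Lax.OplaxTrans

variable {X : Type u₁} [Bicategory.{w₁, v₁} X] {Y : Type u₂} [Bicategory.{w₂, v₂} Y]
  {F F' G G' : X ⥤ᴸ Y}

/-- The axioms of an oplax transformation are propositions, so only the components and 2-morphisms
matter once the end functors are identified. This serves the round trip from iterated
transformations through distributive laws. -/
theorem heq_of_components (hF : F = F') (hG : G = G') {θ : F ⟶ G} {θ' : F' ⟶ G'}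
    (happ : ∀ a, HEq (θ.app a) (θ'.app a))
    (hn : ∀ {a b : X} (f : a ⟶ b), HEq (θ.naturality f) (θ'.naturality f)) : HEq θ θ' := by
  subst hF hG
  obtain ⟨app, n, _, _, _⟩ := θ
  obtain ⟨app', n', _, _, _⟩ := θ'
  obtain rfl : app = app' := funext fun a => eq_of_heq (happ a)
  obtain rfl : @n = @n' := by
    funext a b f
    exact eq_of_heq (hn f)
  rfl

theorem hom_heq_of_components (hF : F = F') (hG : G = G') {θ ζ : F ⟶ G} {θ' ζ' : F' ⟶ G'}
    (hθ : HEq θ θ') (hζ : HEq ζ ζ') {Γ : θ ⟶ ζ} {Λ : θ' ⟶ ζ'}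
    (happ : ∀ a, HEq (Γ.as.app a) (Λ.as.app a)) : HEq Γ Λ := by
  subst hF hG
  obtain rfl := eq_of_heq hθ
  obtain rfl := eq_of_heq hζ
  exact heq_of_eq (homCategory.ext fun a => eq_of_heq (happ a))

end CategoryTheory.Lax.OplaxTrans

/-! ### Functoriality of collation on 1-morphisms. -/

namespace DistLaw

variable {B : Type u₁} [Bicategory.{w₁, v₁} B] {C : Type u₂} [Bicategory.{w₂, v₂} C]
    {D : Type u₃} [Bicategory.{w₃, v₃} D]

/-- Both families of the identity consist of unitors, so the claim is an instance of coherence. -/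
theorem collateNat_id (σ : DistLaw B C D) {b b' : B} {c c' : C} (f : b ⟶ b') (g : c ⟶ c') :
    (Hom.id σ).collateNat f g = (ρ_ (σ.collateMap f g)).hom ≫ (λ_ (σ.collateMap f g)).inv := by
  dsimp only [Hom.collateNat, collateMap, Hom.id, OplaxTransOn.id]
  bicategory

/-- The left side applies the 2-morphisms of `θ` and `ζ` at `g`, then those at `f`. The right side
applies both 2-morphisms of `θ`, then both of `ζ`. Passing from one to the other swaps `ζ` at `g`
with `θ` at `f`; Yang–Baxter plays no role. -/
theorem collateNat_comp {σ τ υ : DistLaw B C D} (θ : Hom σ τ) (ζ : Hom τ υ) {b b' : B} {c c' : C}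
    (f : b ⟶ b') (g : c ⟶ c') :
    (θ.comp ζ).collateNat f g =
      (α_ _ _ _).inv ≫ θ.collateNat f g ▷ ζ.app b' c' ≫ (α_ _ _ _).hom ≫
        θ.app b c ◁ ζ.collateNat f g ≫ (α_ _ _ _).inv := by
  dsimp only [Hom.collateNat, collateMap, Hom.comp, OplaxTransOn.comp]
  calc
    _ = 𝟙 _ ⊗≫ (σ.L c).map f ◁ (θ.M b').naturality g ▷ ζ.app b' c' ⊗≫
        (((σ.L c).map f ≫ θ.app b' c) ◁ (ζ.M b').naturality g ≫
          (θ.L c).naturality f ▷ (ζ.app b' c ≫ (υ.M b').map g)) ⊗≫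
        θ.app b c ◁ (ζ.L c).naturality f ▷ (υ.M b').map g ⊗≫ 𝟙 _ := by
      bicategory
    _ = _ := by
      -- The interchange law for `(θ.L c).naturality f` and `(ζ.M b').naturality g`.
      rw [whisker_exchange]
      bicategory

theorem collate_hom_id (σ : DistLaw B C D) : Hom.collate (𝟙 σ) = 𝟙 σ.collate :=
  Lax.OplaxTrans.mk_congr _ fun f => σ.collateNat_id f.1 f.2

theorem collate_hom_comp {σ τ υ : DistLaw B C D} (θ : σ ⟶ τ) (ζ : τ ⟶ υ) :
    Hom.collate (θ ≫ ζ) = Hom.collate θ ≫ Hom.collate ζ :=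
  Lax.OplaxTrans.mk_congr _ fun f => collateNat_comp θ ζ f.1 f.2

/-! ### Identities between the assignments at the level of data. -/

theorem iteration_comp_deiteration :
    (iteration B C D).comp (deiteration B C D) = PrelaxFunctorStruct.id (DistLaw B C D) :=
  rfl

/-- Every field of `Q` is unpacked and put back unchanged, so the equality is eta for structures
together with proof irrelevance. -/
theorem toIterated_ofIterated (Q : B ⥤ᴸ (C ⥤ᴸ D)) : (ofIterated Q).toIterated = Q := rfl

theorem Hom.toIterated_ofIterated {Q R : B ⥤ᴸ (C ⥤ᴸ D)} (θ : Q ⟶ R) :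
    HEq (Hom.ofIterated θ).toIterated θ :=
  Lax.OplaxTrans.heq_of_components (DistLaw.toIterated_ofIterated Q)
    (DistLaw.toIterated_ofIterated R) (fun _ => HEq.rfl) (fun _ => HEq.rfl)

theorem Hom₂.toIterated_ofIterated {Q R : B ⥤ᴸ (C ⥤ᴸ D)} {θ ζ : Q ⟶ R} (Γ : θ ⟶ ζ) :
    HEq (Hom₂.ofIterated Γ).toIterated Γ :=
  Lax.OplaxTrans.hom_heq_of_components (DistLaw.toIterated_ofIterated Q)
    (DistLaw.toIterated_ofIterated R) (Hom.toIterated_ofIterated θ)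
    (Hom.toIterated_ofIterated ζ) (fun _ => HEq.rfl)

theorem deiteration_comp_iteration :
    (deiteration B C D).comp (iteration B C D) = PrelaxFunctorStruct.id (B ⥤ᴸ (C ⥤ᴸ D)) :=
  PrelaxFunctorStruct.eq_id toIterated_ofIterated Hom.toIterated_ofIterated
    Hom₂.toIterated_ofIterated

theorem iteration_comp_uncurrying :
    (iteration B C D).comp (uncurrying B C D) = collation B C D :=
  rfl

/-- This makes uncurrying a strict 2-functor: it inherits functoriality from extraction and
collation. -/
theorem deiteration_comp_collation :
    (deiteration B C D).comp (collation B C D) = uncurrying B C D :=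
  rfl

/-! ### The strict 2-functors; strictness of `D` passes to the 2-categories involved, so no
associator or unitor conditions remain. -/

variable [Strict D]

variable (B C D)

/-- Iteration of distributive laws as a strict 2-functor. -/
def iterationFunctor : StrictPseudofunctor (DistLaw B C D) (B ⥤ᴸ (C ⥤ᴸ D)) :=
  .mk''
    { toPrelaxFunctorStruct := iteration B C D
      map₂_id _ := rfl
      map₂_comp _ _ := rfl
      map_id _ := rfl
      map_comp _ _ := rfl
      -- Composites are preserved definitionally, so the comparison `eqToHom`s are identities.
      map₂_whisker_left _ _ _ _ := ((Category.id_comp _).trans (Category.comp_id _)).symm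
      map₂_whisker_right _ _ := ((Category.id_comp _).trans (Category.comp_id _)).symm }

/-- Extraction of distributive laws from iterated lax functors as a strict 2-functor. -/
def deiterationFunctor : StrictPseudofunctor (B ⥤ᴸ (C ⥤ᴸ D)) (DistLaw B C D) :=
  .mk''
    { toPrelaxFunctorStruct := deiteration B C D
      map₂_id _ := rfl
      map₂_comp _ _ := rfl
      map_id _ := rfl
      map_comp _ _ := rfl
      map₂_whisker_left _ _ _ _ := ((Category.id_comp _).trans (Category.comp_id _)).symm
      map₂_whisker_right _ _ := ((Category.id_comp _).trans (Category.comp_id _)).symm }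

/-- Collation of distributive laws as a strict 2-functor. -/
def collationFunctor : StrictPseudofunctor (DistLaw B C D) (B × C ⥤ᴸ D) :=
  .mk''
    { toPrelaxFunctorStruct := collation B C D
      map₂_id _ := rfl
      map₂_comp _ _ := rfl
      map_id := collate_hom_id
      map_comp := collate_hom_comp
      -- Here composites are preserved only by a proved equation, so the `eqToHom`s are genuine
      -- transports. The 1-morphism components still agree definitionally, and so do the components
      -- of the modifications.
      map₂_whisker_left _ _ _ _ := Lax.OplaxTrans.eq_eqToHom_comp_comp _ _ fun _ => HEq.rfl
      map₂_whisker_right _ _ := Lax.OplaxTrans.eq_eqToHom_comp_comp _ _ fun _ => HEq.rfl }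

end DistLaw

theorem theorem4 {B : Type u₁} [Bicategory.{w₁, v₁} B] [Strict B]
    {C : Type u₂} [Bicategory.{w₂, v₂} C] [Strict C]
    {D : Type u₃} [Bicategory.{w₃, v₃} D] [Strict D] :
    ∃ (K : StrictPseudofunctor (DistLaw B C D) (B × C ⥤ᴸ D))
      (Φ : StrictPseudofunctor (DistLaw B C D) (B ⥤ᴸ (C ⥤ᴸ D)))
      (Ψ : StrictPseudofunctor (B ⥤ᴸ (C ⥤ᴸ D)) (DistLaw B C D))
      (J : StrictPseudofunctor (B ⥤ᴸ (C ⥤ᴸ D)) (B × C ⥤ᴸ D)),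
      K.toPrelaxFunctorStruct = DistLaw.collation B C D ∧
      Φ.toPrelaxFunctorStruct = DistLaw.iteration B C D ∧
      Ψ.toPrelaxFunctorStruct = DistLaw.deiteration B C D ∧
      J.toPrelaxFunctorStruct = uncurrying B C D ∧
      Φ.comp Ψ = StrictPseudofunctor.id (DistLaw B C D) ∧
      Ψ.comp Φ = StrictPseudofunctor.id (B ⥤ᴸ (C ⥤ᴸ D)) ∧
      Φ.comp J = K := by
  -- The witness for `J` is `Ψ` followed by `K`; its data are those of `uncurrying`.
  have hJ := (StrictPseudofunctor.comp_toPrelaxFunctorStruct (DistLaw.deiterationFunctor B C D)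
    (DistLaw.collationFunctor B C D)).trans (DistLaw.deiteration_comp_collation (B := B))
  refine ⟨DistLaw.collationFunctor B C D, DistLaw.iterationFunctor B C D,
    DistLaw.deiterationFunctor B C D,
    (DistLaw.deiterationFunctor B C D).comp (DistLaw.collationFunctor B C D), rfl, rfl, rfl, hJ,
    StrictPseudofunctor.ext_of_toPrelaxFunctorStruct ?_,
    StrictPseudofunctor.ext_of_toPrelaxFunctorStruct ?_,
    StrictPseudofunctor.ext_of_toPrelaxFunctorStruct ?_⟩
  · exact (StrictPseudofunctor.comp_toPrelaxFunctorStruct _ _).trans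
      (DistLaw.iteration_comp_deiteration.trans
        StrictPseudofunctor.id_toPrelaxFunctorStruct.symm)
  · exact (StrictPseudofunctor.comp_toPrelaxFunctorStruct _ _).trans
      (DistLaw.deiteration_comp_iteration.trans
        StrictPseudofunctor.id_toPrelaxFunctorStruct.symm)
  · exact (StrictPseudofunctor.comp_toPrelaxFunctorStruct _ _).trans
      ((congrArg (DistLaw.iteration B C D).comp hJ).trans DistLaw.iteration_comp_uncurrying)
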